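/- **Setting.** Let $\Gamma$ be the countable vertex set of a connected graph, with graph distance $d(x,y)$; distances to the empty set are $+\infty$. Let $F:[0,\infty)\to(0,\infty)$ satisfy $$\|F\|:=\sup_{x\in\Gamma}\sum_{y\in\Gamma}F(d(x,y))<\infty,\qquad C_F:=\sup_{x,z\in\Gamma}\sum_{y\in\Gamma}\frac{F(d(x,y))F(d(y,z))}{F(d(x,z))}<\infty .$$ Let $\xi:[0,\infty)\to(0,\infty)$ be non-increasing with $\xi(a+b)\ge\xi(a)\xi(b)$ and $\lim_{r\to\infty}\xi(r)r^n=0$ for all $n\in\mathbb N$. Put $F_\xi:=F\,\xi$, let $\|F_\xi\|$ and $C_\xi$ be the quantities $\|F\|$ and $C_F$ with $F$ replaced by $F_\xi$, and let $\zeta(R):=\sum_{r\ge R+1}\xi(r)$ (sum over integers $r$). For finite $\Lambda\subset\Gamma$ let $\mathcal H_\Lambda=\bigotimes_{x\in\Lambda}\mathcal H_x$ with $\dim\mathcal H_x<\infty$, and let $\mathcal A_\Lambda=\mathcal B(\mathcal H_\Lambda)$, embedded in $\mathcal A_{\Lambda'}$ for $\Lambda\subset\Lambda'$ by tensoring with the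 identity. Fix $T\in(0,\infty)$. For every finite $Z\subset\Gamma$ let $[-T,T]\ni t\mapsto\Psi(Z,t)=\Psi(Z,t)^*\in\mathcal A_Z$ be continuous, with $\Psi(\emptyset,t)=0$, and assume $$\|\Psi\|_\xi:=\sup_{x,y\in\Gamma}\frac1{F_\xi(d(x,y))}\sum_{Z\ni x,y}\ \sup_{t\in[-T,T]}\|\Psi(Z,t)\|<\infty .$$ Put $v_\xi:=2\|\Psi\|_\xi C_\xi$ and $H_\Lambda(t):=\sum_{Z\subset\Lambda}\Psi(Z,t)$. Let $U_\Lambda(t,s)$ be the solution of $\mathrm i\frac{\mathrm d}{\mathrm dt}U_\Lambda(t,s)=H_\Lambda(t)U_\Lambda(t,s)$, $U_\Lambda(s,s)=1$, for $s,t\in[-T,T]$, and let $\tau_\Lambda^{t,s}(A):=U_\Lambda(t,s)^*AU_\Lambda(t,s)$. For finite $X\subset\Gamma$ and an integer $R\ge0$ let $\partial X:=\{x\in X:d(x,\Gamma\setminus X)=1\}$, $\overline X^R:=\{x:d(x,X)\le R\}$, $\underline X_R:=\{x:d(x,\Gamma\setminus X)\le R\}$ and $\partial_RX:=\overline X^R\cap\underline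 X_R$. Assume that there are constants $G>0$ and $d\ge0$ (a real exponent, not the distance function) with $|\partial_RX|\le G R^d|\partial X|$ for all finite $X\subset\Gamma$ and all $R$. **Theorem.** Let $X\subset\Gamma$ be a finite set such that $n\mapsto|\underline X_n\setminus\underline X_{n-1}|$ $(n\ge1)$ is non-increasing, and let $s,t\in[-T,T]$. Every $U_\Lambda(\cdot,s)$ exists on $[-T,T]$ and is unitary. Let $R\ge 0$ be an integer, and let $\Lambda\subset\Gamma$ be a finite set with $\overline X^R\subset\Lambda$. Write $R/2$ for $\lfloor R/2\rfloor$ and let $$S(R,t):=\sum_{Z\subset\partial_{R/2}X,\ Z\cap X\ne\emptyset,\ Z\setminus X\neq\emptyset}\Psi(Z,t).$$ Then the initial value problem $$-\mathrm i\frac{\mathrm d}{\mathrm dt}\tilde U_{\partial_RX}(t,s)=\tau_{\partial_RX}^{t,s}(S(R,t))\,\tilde U_{\partial_RX}(t,s),\qquad \tilde U_{\partial_RX}(s,s)=1,$$ has a solution on $[-T,T]$ with values in the unitary elements of $\mathcal A_{\partial_RX}$, and $$\Big\|U_\Lambda(t,s)-\big(U_X(t,s)\otimes U_{\Lambda\setminus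 X}(t,s)\big)\tilde U_{\partial_RX}(t,s)^*\Big\|\le|\partial X|\,\|\Psi\|_\xi\,\|F\|\,|t-s|\Big[2\zeta(R/2)+|\partial X|\,\kappa\,(R/2)^{2d}\,\xi(R/2)\big(e^{v_\xi|t-s|}-1\big)\Big],$$ where $\kappa=G^2\|F_\xi\|/C_\xi$. The right-hand side does not depend on $\Lambda$, and for fixed $X,s,t$ it decays faster than any inverse power of $R$ as $R\to\infty$. -/

import Mathlib

open Set Filter Topology
open scoped Matrix.Norms.L2Operator

namespace SpinSystem

noncomputable section

/-! ### Geometry of the graph -/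

section Geometry

variable {Γ : Type*} [DecidableEq Γ]

/-- The distance `d(x, S)` of a vertex to a set, equal to `⊤` for `S = ∅`. -/
def setDist (𝒢 : SimpleGraph Γ) (x : Γ) (S : Set Γ) : ℕ∞ :=
  ⨅ y ∈ S, (𝒢.dist x y : ℕ∞)

/-- The inner boundary `∂X = {x ∈ X : d(x, Γ \ X) = 1}`. -/
def innerBoundary (𝒢 : SimpleGraph Γ) (X : Finset Γ) : Set Γ :=
  {x | x ∈ X ∧ setDist 𝒢 x (X : Set Γ)ᶜ = 1}

/-- The fattening of `X`, the set of all `x` with `d(x, X) ≤ R`. -/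
def outerFat (𝒢 : SimpleGraph Γ) (X : Finset Γ) (R : ℕ) : Set Γ :=
  {x | setDist 𝒢 x (X : Set Γ) ≤ R}

/-- The fattening of the complement of `X`, the set of all `x` with `d(x, Γ \ X) ≤ R`. -/
def innerFat (𝒢 : SimpleGraph Γ) (X : Finset Γ) (R : ℕ) : Set Γ :=
  {x | setDist 𝒢 x (X : Set Γ)ᶜ ≤ R}

/-- The `R`-neighbourhood `∂_R X` of the surface of `X`. -/
def fatBoundary (𝒢 : SimpleGraph Γ) (X : Finset Γ) (R : ℕ) : Set Γ :=
  outerFat 𝒢 X R ∩ innerFat 𝒢 X R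

open Classical in
/-- `∂_R X` as a finset. (Balls are finite wherever this is used, so the second case is void.) -/
def fatBdry (𝒢 : SimpleGraph Γ) (X : Finset Γ) (R : ℕ) : Finset Γ :=
  if h : (fatBoundary 𝒢 X R).Finite then h.toFinset else ∅

theorem subset_of_outerFat_subset {𝒢 : SimpleGraph Γ} {X Λ : Finset Γ} {R : ℕ}
    (h : outerFat 𝒢 X R ⊆ (Λ : Set Γ)) : X ⊆ Λ := by
  intro x hx
  have : setDist 𝒢 x (X : Set Γ) ≤ (R : ℕ∞) := by
    refine (iInf₂_le x (by exact_mod_cast hx)).trans ?_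
    simp
  exact_mod_cast h this

/-- `‖F‖ = sup_x ∑_y F(d(x,y))`. -/
def intNorm (𝒢 : SimpleGraph Γ) (F : ℝ → ℝ) : ℝ :=
  ⨆ x : Γ, ∑' y : Γ, F (𝒢.dist x y)

/-- `C_F = sup_{x,z} ∑_y F(d(x,y)) F(d(y,z)) / F(d(x,z))`. -/
def convConst (𝒢 : SimpleGraph Γ) (F : ℝ → ℝ) : ℝ :=
  ⨆ p : Γ × Γ, ∑' y : Γ, F (𝒢.dist p.1 y) * F (𝒢.dist y p.2) / F (𝒢.dist p.1 p.2)

/-- The tail `ζ(R) = ∑_{r ≥ R + 1} ξ(r)`. -/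
def tail (ξ : ℝ → ℝ) (R : ℕ) : ℝ :=
  ∑' k : ℕ, ξ ((R + 1 + k : ℕ) : ℝ)

end Geometry

/-! ### Local algebras -/

section Algebras

variable {Γ : Type*} [DecidableEq Γ]

/-- The labels of the product basis of `⨂_{x ∈ Λ} ℋ_x`, where `ℋ_x = ℂ^(ι x)`. -/
abbrev Cfg (ι : Γ → Type*) (Λ : Finset Γ) : Type _ := ∀ x : Λ, ι x

/-- The algebra `𝒜_Λ` of all operators on `⨂_{x ∈ Λ} ℋ_x`, written as matrices in the product
basis, with the operator norm of the Hilbert space. -/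
abbrev Obs (ι : Γ → Type*) (Λ : Finset Γ) : Type _ := Matrix (Cfg ι Λ) (Cfg ι Λ) ℂ

variable {ι : Γ → Type*} [∀ x, Fintype (ι x)] [∀ x, DecidableEq (ι x)]

/-- The tensor product `A ⊗ B ∈ 𝒜_Λ` of `A ∈ 𝒜_Y` and `B ∈ 𝒜_{Λ \ Y}`, for `Y ⊆ Λ`. -/
def tensor {Y Λ : Finset Γ} (h : Y ⊆ Λ) (A : Obs ι Y) (B : Obs ι (Λ \ Y)) : Obs ι Λ :=
  Matrix.of fun η η' =>
    A (Finset.restrict₂ h η) (Finset.restrict₂ h η') *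
      B (Finset.restrict₂ Finset.sdiff_subset η) (Finset.restrict₂ Finset.sdiff_subset η')

/-- The canonical embedding `A ↦ A ⊗ 1` of `𝒜_Y` into `𝒜_Λ` (only used for `Y ⊆ Λ`). -/
def embed {Y : Finset Γ} (Λ : Finset Γ) (A : Obs ι Y) : Obs ι Λ :=
  if h : Y ⊆ Λ then tensor h A 1 else 0

/-- `U : [-T, T] → 𝒜` solves `U' = A U`, `U(s) = 1` (with one-sided derivatives at `± T`). -/
def IsSolution {Λ : Finset Γ} (T s : ℝ) (A U : ℝ → Obs ι Λ) : Prop :=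
  U s = 1 ∧ ∀ t ∈ Icc (-T) T, HasDerivWithinAt U (A t * U t) (Icc (-T) T) t

/-- The solution on `[-T, T]` of `U' = A U`, `U(s) = 1`. -/
def solution {Λ : Finset Γ} (T s : ℝ) (A : ℝ → Obs ι Λ) : ℝ → Obs ι Λ :=
  Classical.epsilon (IsSolution T s A)

end Algebras

/-! ### Dynamics -/

section Dynamics

variable {Γ : Type*} [DecidableEq Γ]
  {ι : Γ → Type*} [∀ x, Fintype (ι x)] [∀ x, DecidableEq (ι x)]

/-- `sup_{t ∈ [-T, T]} ‖Ψ(Z, t)‖`. -/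
def supNorm (T : ℝ) (Ψ : ∀ Z : Finset Γ, ℝ → Obs ι Z) (Z : Finset Γ) : ℝ :=
  ⨆ t : Icc (-T) T, ‖Ψ Z t‖

/-- `F(d(x,y))⁻¹ ∑_{Z ∋ x, y} sup_{t ∈ [-T, T]} ‖Ψ(Z, t)‖`. -/
def pairStrength (𝒢 : SimpleGraph Γ) (F : ℝ → ℝ) (T : ℝ) (Ψ : ∀ Z : Finset Γ, ℝ → Obs ι Z)
    (x y : Γ) : ℝ :=
  1 / F (𝒢.dist x y) * ∑' Z : {Z : Finset Γ // x ∈ Z ∧ y ∈ Z}, supNorm T Ψ Z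

/-- The norm of an interaction relative to a decay function `F`. -/
def intrNorm (𝒢 : SimpleGraph Γ) (F : ℝ → ℝ) (T : ℝ) (Ψ : ∀ Z : Finset Γ, ℝ → Obs ι Z) : ℝ :=
  ⨆ p : Γ × Γ, pairStrength 𝒢 F T Ψ p.1 p.2

/-- The Hamiltonian `H_Λ(t) = ∑_{Z ⊆ Λ} Ψ(Z, t)`. -/
def ham (Ψ : ∀ Z : Finset Γ, ℝ → Obs ι Z) (Λ : Finset Γ) (t : ℝ) : Obs ι Λ :=
  ∑ Z ∈ Λ.powerset, embed Λ (Ψ Z t)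

/-- The unitary cocycle `U_Λ(t, s)`, the solution of `i dU/dt = H_Λ(t) U`, `U(s, s) = 1`. -/
def evol (T : ℝ) (Ψ : ∀ Z : Finset Γ, ℝ → Obs ι Z) (Λ : Finset Γ) (t s : ℝ) : Obs ι Λ :=
  solution T s (fun r => -Complex.I • ham Ψ Λ r) t

/-- The Heisenberg evolution `τ_Λ^{t,s}(A) = U_Λ(t, s)^* A U_Λ(t, s)`. -/
def heis (T : ℝ) (Ψ : ∀ Z : Finset Γ, ℝ → Obs ι Z) (Λ : Finset Γ) (t s : ℝ)
    (A : Obs ι Λ) : Obs ι Λ :=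
  star (evol T Ψ Λ t s) * A * evol T Ψ Λ t s

/-- The sets `Y ⊆ ∂_{⌊R/2⌋} X` that meet both `X` and its complement. -/
def crossing (𝒢 : SimpleGraph Γ) (X : Finset Γ) (R : ℕ) : Finset (Finset Γ) :=
  {Y ∈ (fatBdry 𝒢 X (R / 2)).powerset | (Y ∩ X).Nonempty ∧ (Y \ X).Nonempty}

/-- The surface energy `S(R, t)`, as an element of the algebra of `∂_R X`. -/
def surfaceEnergy (𝒢 : SimpleGraph Γ) (Ψ : ∀ Z : Finset Γ, ℝ → Obs ι Z) (X : Finset Γ)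
    (R : ℕ) (t : ℝ) : Obs ι (fatBdry 𝒢 X R) :=
  ∑ Z ∈ crossing 𝒢 X R, embed (fatBdry 𝒢 X R) (Ψ Z t)

/-- The generator `i τ_{∂_R X}^{t,s}(S(R, t))` of the surface evolution started at time `s`. -/
def surfaceGen (𝒢 : SimpleGraph Γ) (T : ℝ) (Ψ : ∀ Z : Finset Γ, ℝ → Obs ι Z) (X : Finset Γ)
    (R : ℕ) (s t : ℝ) : Obs ι (fatBdry 𝒢 X R) :=
  Complex.I • heis T Ψ (fatBdry 𝒢 X R) t s (surfaceEnergy 𝒢 Ψ X R t)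

/-- The surface evolution, solution of `-i dU/dt = τ_{∂_R X}^{t,s}(S(R, t)) U`, `U(s, s) = 1`. -/
def surfaceEvol (𝒢 : SimpleGraph Γ) (T : ℝ) (Ψ : ∀ Z : Finset Γ, ℝ → Obs ι Z) (X : Finset Γ)
    (R : ℕ) (t s : ℝ) : Obs ι (fatBdry 𝒢 X R) :=
  solution T s (surfaceGen 𝒢 T Ψ X R s) t

/-- The error bound
`|∂X| ‖Ψ‖_ξ ‖F‖ |t-s| [2 ζ(R/2) + |∂X| κ (R/2)^{2d} ξ(R/2) (e^{v_ξ |t-s|} - 1)]`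
with `κ = G² ‖F_ξ‖ / C_ξ`, `v_ξ = 2 ‖Ψ‖_ξ C_ξ`, `F_ξ = F ξ`, where `R/2` means `⌊R/2⌋`. -/
def errorBound (𝒢 : SimpleGraph Γ) (F ξ : ℝ → ℝ) (G d T : ℝ)
    (Ψ : ∀ Z : Finset Γ, ℝ → Obs ι Z) (X : Finset Γ) (R : ℕ) (t s : ℝ) : ℝ :=
  let Fξ : ℝ → ℝ := fun r => F r * ξ r
  let b : ℝ := (innerBoundary 𝒢 X).ncard
  let ψ : ℝ := intrNorm 𝒢 Fξ T Ψ
  let κ : ℝ := G ^ 2 * intNorm 𝒢 Fξ / convConst 𝒢 Fξ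
  let v : ℝ := 2 * ψ * convConst 𝒢 Fξ
  let h : ℕ := R / 2
  b * ψ * intNorm 𝒢 F * |t - s| *
    (2 * tail ξ h + b * κ * (h : ℝ) ^ (2 * d) * ξ h * (Real.exp (v * |t - s|) - 1))

end Dynamics

end

end SpinSystem

/-! Write `V = U_X ⊗ U_{Λ∖X}`. Its generator is `H_Λ` without the terms that cross the surface of
`X`, so `U_Λ* V` is generated by `i τ_Λ(H_Λ - K)`, where `H_Λ - K` is the sum of the crossing terms.
If `E` solves the same equation with a generator `i G` for which `‖τ_Λ(H_Λ - K) - G‖ ≤ c` between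
`s` and `t`, then differentiating `E* U_Λ* V`, a product of unitaries, gives `‖U_Λ - V E*‖ ≤ c |t -
s|` (`norm_sub_mul_star_le`). It remains to show that `G = τ_{∂_R X}(S)` is such a generator, with
two sources of error.

First, the crossing terms not supported in `∂_{R/2} X` are discarded (`sum_crossing_far_le`). Such a
term links a point of `X` of depth more than `R/2` to the complement, or a point of `X` to a vertex
at distance more than `R/2` from `X`. Each case is summed over the inner layers of `X`, all of size
at most `|∂X|`, and contributes one `ζ(R/2)`.

Second, `τ_Λ(S)` is replaced by `τ_{∂_R X}(S)` (`norm_heis_sub_embed_heis_le`). By the Lieb-Robinson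
bound the error is at most `‖S‖ C_ξ⁻¹ (e^{v_ξ |t - s|} - 1)` times the sum of `F_ξ(d(y, w))` over `y
∈ ∂_{R/2} X` and `w ∈ Λ ∖ ∂_R X`. These points are at distance at least `R/2`, so the double sum is
at most `|∂_{R/2} X| ‖F‖ ξ(R/2)`. Also `‖S‖ ≤ ‖Ψ‖_ξ |∂_{R/2} X| ‖F_ξ‖`, and the growth assumption
bounds both cardinalities; this produces `κ` and the exponent `2d`.

The Lieb-Robinson bound is proved by iteration: terms disjoint from the support of an observable are
removed by an interaction picture, and the convolution property of `F_ξ` makes the exponential bound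
reproduce itself, up to a remainder `x^n / n!` (`norm_commutator_le_add_remainder`). -/

namespace SpinSystem

/-! ### Linear differential equations in a Banach algebra. -/

section LinearODE

variable {𝔄 : Type*} [NormedRing 𝔄] [NormedAlgebra ℝ 𝔄] [CompleteSpace 𝔄]

/-- The terms of the Dyson series of `U' = A U`, `U(s) = 1`. -/
noncomputable def dysonTerm (A : ℝ → 𝔄) (s : ℝ) : ℕ → ℝ → 𝔄
  | 0 => fun _ => 1
  | n + 1 => fun t => ∫ r in s..t, A r * dysonTerm A s n r

omit [CompleteSpace 𝔄] in
theorem continuous_dysonTerm {A : ℝ → 𝔄} (hA : Continuous A) (s : ℝ) (n : ℕ) :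
    Continuous (dysonTerm A s n) := by
  induction n with
  | zero => exact continuous_const
  | succ n ih =>
    exact intervalIntegral.continuous_primitive
      (fun a b => Continuous.intervalIntegrable (μ := MeasureTheory.volume) (hA.mul ih) a b) s

theorem hasDerivAt_dysonTerm_succ {A : ℝ → 𝔄} (hA : Continuous A) (s : ℝ) (n : ℕ) (t : ℝ) :
    HasDerivAt (dysonTerm A s (n + 1)) (A t * dysonTerm A s n t) t :=
  intervalIntegral.integral_hasDerivAt_right
    ((hA.mul (continuous_dysonTerm hA s n)).intervalIntegrable _ _)
    ((hA.mul (continuous_dysonTerm hA s n)).stronglyMeasurableAtFilter _ _)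
    (hA.mul (continuous_dysonTerm hA s n)).continuousAt

-- Each iterated integration of `|r - s|^n` contributes a factor `|t - s| / (n + 1)`, whence the
-- factorial that makes the Dyson series converge.
omit [CompleteSpace 𝔄] in
theorem norm_dysonTerm_le {A : ℝ → 𝔄} {K : ℝ} (hK : ∀ r, ‖A r‖ ≤ K)
    (s : ℝ) (n : ℕ) (t : ℝ) :
    ‖dysonTerm A s n t‖ ≤ ‖(1 : 𝔄)‖ * ((K * |t - s|) ^ n / n.factorial) := by
  have hK0 : 0 ≤ K := (norm_nonneg _).trans (hK 0)
  induction n generalizing t with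
  | zero => simp [dysonTerm]
  | succ n ih =>
    have hb : ∀ r, ‖A r * dysonTerm A s n r‖ ≤
        ‖(1 : 𝔄)‖ * K ^ (n + 1) / n.factorial * |r - s| ^ n := fun r => by
      calc ‖A r * dysonTerm A s n r‖ ≤ ‖A r‖ * ‖dysonTerm A s n r‖ := norm_mul_le _ _
        _ ≤ K * (‖(1 : 𝔄)‖ * ((K * |r - s|) ^ n / n.factorial)) := by
            gcongr
            · exact hK r
            · exact ih r
        _ = _ := by rw [mul_pow, pow_succ]; ring
    calc ‖dysonTerm A s (n + 1) t‖
        ≤ ∫ r in uIoc s t, ‖A r * dysonTerm A s n r‖ :=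
          intervalIntegral.norm_integral_le_integral_norm_uIoc
      _ ≤ ∫ r in uIoc s t, ‖(1 : 𝔄)‖ * K ^ (n + 1) / n.factorial * |r - s| ^ n := by
          refine MeasureTheory.integral_mono_of_nonneg (Eventually.of_forall fun _ => norm_nonneg _)
            ?_ (Eventually.of_forall hb)
          exact (Continuous.integrableOn_uIoc (by fun_prop))
      _ = _ := by
          rw [MeasureTheory.integral_const_mul, integral_pow_abs_sub_uIoc, Nat.factorial_succ,
            mul_pow]
          push_cast
          field_simp

/-- Global existence for linear differential equations with continuous bounded coefficients. -/
theorem exists_forall_hasDerivAt_of_continuous {A : ℝ → 𝔄} (hA : Continuous A) {K : ℝ}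
    (hK : ∀ r, ‖A r‖ ≤ K) (s : ℝ) :
    ∃ U : ℝ → 𝔄, U s = 1 ∧ ∀ t, HasDerivAt U (A t * U t) t := by
  have hK0 : 0 ≤ K := (norm_nonneg _).trans (hK 0)
  have hsum : ∀ t, Summable fun n => dysonTerm A s n t := fun t =>
    Summable.of_norm_bounded ((Real.summable_pow_div_factorial (K * |t - s|)).mul_left _)
      fun n => norm_dysonTerm_le hK s n t
  refine ⟨fun t => ∑' n, dysonTerm A s n t, ?_, fun t => ?_⟩
  · change ∑' n, dysonTerm A s n s = 1
    rw [(hsum s).tsum_eq_zero_add]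
    simp [dysonTerm]
  · have hU : (fun t => ∑' n, dysonTerm A s n t) =
        fun t => 1 + ∑' n, dysonTerm A s (n + 1) t := by
      ext t
      rw [(hsum t).tsum_eq_zero_add]
      rfl
    -- Termwise differentiation on the ball of radius `|t - s| + 1` about `s`: it contains both `t`
    -- and the base point `s`, and the Dyson bounds are uniform on it.
    have key : HasDerivAt (fun t => ∑' n, dysonTerm A s (n + 1) t)
        (∑' n, A t * dysonTerm A s n t) t := by
      refine hasDerivAt_tsum_of_isPreconnected (t := Metric.ball s (|t - s| + 1))
        (u := fun n => K * (‖(1 : 𝔄)‖ * ((K * (|t - s| + 1)) ^ n / n.factorial)))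
        (((Real.summable_pow_div_factorial _).mul_left _).mul_left _)
        (g := fun n => dysonTerm A s (n + 1)) (g' := fun n t => A t * dysonTerm A s n t)
        Metric.isOpen_ball (convex_ball _ _).isPreconnected
        (fun n y _ => hasDerivAt_dysonTerm_succ hA s n y) ?_ (y₀ := s)
        (Metric.mem_ball_self (by positivity)) ?_ ?_
      · intro n y hy
        rw [Metric.mem_ball, Real.dist_eq] at hy
        refine (norm_mul_le _ _).trans ?_
        gcongr
        · exact hK y
        · refine (norm_dysonTerm_le hK s n y).trans ?_
          gcongr
      · exact (summable_nat_add_iff (f := fun n => dysonTerm A s n s) 1).2 (hsum s)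
      · rw [Metric.mem_ball, Real.dist_eq]; linarith
    have := key.const_add (1 : 𝔄)
    rw [(hsum t).tsum_mul_left, ← hU] at this
    exact this

/-- Existence for linear differential equations with continuous coefficients on an interval. -/
theorem exists_hasDerivWithinAt_of_continuousOn {A : ℝ → 𝔄} {a b : ℝ} (hab : a ≤ b)
    (hA : ContinuousOn A (Icc a b)) (s : ℝ) :
    ∃ U : ℝ → 𝔄, U s = 1 ∧ ∀ t ∈ Icc a b, HasDerivWithinAt U (A t * U t) (Icc a b) t := by
  obtain ⟨K, hK⟩ := isCompact_Icc.exists_bound_of_continuousOn hA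
  -- The coefficient is extended constantly beyond the endpoints, which keeps it continuous and
  -- bounded by `K`.
  obtain ⟨U, hU1, hU⟩ := exists_forall_hasDerivAt_of_continuous
    (A := IccExtend hab ((Icc a b).domRestrict A))
    (continuous_IccExtend_iff.2 (continuousOn_iff_continuous_domRestrict.1 hA)) (K := K)
    (fun r => hK _ (projIcc a b hab r).2) s
  refine ⟨U, hU1, fun t ht => ?_⟩
  have := hU t
  rw [IccExtend_of_mem _ _ ht] at this
  exact this.hasDerivWithinAt

end LinearODE

/-! ### Unitarity of evolutions with skew-adjoint generator. -/

section Unitary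

variable {𝔄 : Type*} [CStarAlgebra 𝔄]

/-- The solution of `U' = A U`, `U(s) = 1`, is unitary if `A` is skew-adjoint. -/
theorem mem_unitary_of_hasDerivWithinAt [IsDedekindFiniteMonoid 𝔄] {A U : ℝ → 𝔄} {a b s : ℝ}
    (hs : s ∈ Icc a b)
    (hA : ∀ t ∈ Icc a b, star (A t) = -A t) (hU1 : U s = 1)
    (hU : ∀ t ∈ Icc a b, HasDerivWithinAt U (A t * U t) (Icc a b) t) {t : ℝ}
    (ht : t ∈ Icc a b) : U t ∈ unitary (𝔄) := by
  have h : ∀ t ∈ Icc a b, HasDerivWithinAt (fun t => star (U t) * U t) 0 (Icc a b) t := by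
    intro t ht
    refine HasDerivWithinAt.congr_deriv ((hU t ht).star.mul (hU t ht)) ?_
    rw [star_mul, hA t ht]
    noncomm_ring
  have := Convex.norm_image_sub_le_of_norm_hasDerivWithin_le h (C := 0) (by simp)
    (convex_Icc a b) hs ht
  have h1 : star (U t) * U t = 1 := by
    rw [zero_mul, norm_le_zero_iff, sub_eq_zero, hU1] at this
    simpa using this
  -- The derivative argument only shows that `U t` is an isometry; Dedekind finiteness makes the
  -- left inverse two-sided.
  exact Unitary.mem_iff.2 ⟨h1, mul_eq_one_comm.1 h1⟩

theorem norm_star_mul_mul_of_mem_unitary {U : 𝔄} (hU : U ∈ unitary (𝔄))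
    (A : 𝔄) : ‖star U * A * U‖ = ‖A‖ := by
  rw [CStarRing.norm_mul_mem_unitary _ hU,
    CStarRing.norm_mem_unitary_mul _ (Unitary.star_mem hU)]

theorem norm_mul_mul_star_of_mem_unitary {U : 𝔄} (hU : U ∈ unitary (𝔄))
    (A : 𝔄) : ‖U * A * star U‖ = ‖A‖ := by
  rw [CStarRing.norm_mul_mem_unitary _ (Unitary.star_mem hU),
    CStarRing.norm_mem_unitary_mul _ hU]

end Unitary

/-! ### A mean value inequality with a time-dependent bound. -/

section MeanValue

variable {E : Type*} [NormedAddCommGroup E] [NormedSpace ℝ E]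

/-- Bounding by a primitive `β`, rather than by a constant speed times length, integrates the
exponentials of the Lieb-Robinson estimates exactly. -/
theorem norm_sub_le_of_norm_hasDerivWithinAt_le {g g' : ℝ → E} {β β' : ℝ → ℝ} {a b : ℝ}
    (hg : ∀ t ∈ Icc a b, HasDerivWithinAt g (g' t) (Icc a b) t)
    (hβ : ∀ t, HasDerivAt β (β' t) t) (hβa : β a = 0)
    (hbound : ∀ t ∈ Icc a b, ‖g' t‖ ≤ β' t) {t : ℝ} (ht : t ∈ Icc a b) :
    ‖g t - g a‖ ≤ β t := by
  refine image_norm_le_of_norm_deriv_right_le_deriv_boundary (f := fun t => g t - g a) (f' := g')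
    ?_ (fun x hx => ?_) (by simp [hβa]) hβ (fun x hx => hbound x (Ico_subset_Icc_self hx)) ht
  · exact fun x hx => ((hg x hx).continuousWithinAt).sub continuousWithinAt_const
  · exact ((hg x (Ico_subset_Icc_self hx)).mono_of_mem_nhdsWithin
      (Icc_mem_nhdsGE_of_mem hx)).sub_const (g a)

end MeanValue

/-! ### Conjugation by evolutions and the interaction picture. -/

section InteractionPicture

variable {𝔄 : Type*} [CStarAlgebra 𝔄]

theorem star_neg_I_smul {H : 𝔄} (hH : IsSelfAdjoint H) :
    star (-Complex.I • H) = -(-Complex.I • H) := by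
  rw [star_smul, hH.star_eq]
  simp

theorem norm_commutator_le (A B : 𝔄) : ‖A * B - B * A‖ ≤ 2 * ‖A‖ * ‖B‖ := by
  calc ‖A * B - B * A‖ ≤ ‖A * B‖ + ‖B * A‖ := norm_sub_le _ _
    _ ≤ ‖A‖ * ‖B‖ + ‖B‖ * ‖A‖ := add_le_add (norm_mul_le _ _) (norm_mul_le _ _)
    _ = _ := by ring

theorem hasDerivWithinAt_conj {H U B : ℝ → 𝔄} {B' : 𝔄} {S : Set ℝ} {t : ℝ}
    (hH : IsSelfAdjoint (H t)) (hU : HasDerivWithinAt U (-Complex.I • H t * U t) S t)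
    (hB : HasDerivWithinAt B B' S t) :
    HasDerivWithinAt (fun r => star (U r) * B r * U r)
      (star (U t) * (B' + Complex.I • (H t * B t - B t * H t)) * U t) S t := by
  refine ((hU.star.mul hB).mul hU).congr_deriv ?_
  rw [star_mul, star_neg_I_smul hH]
  simp only [Pi.mul_apply, smul_mul_assoc, mul_smul_comm, mul_add, add_mul, mul_sub, sub_mul,
    mul_assoc, mul_neg, neg_mul, neg_smul, smul_sub, neg_neg]
  module

theorem hasDerivWithinAt_conj_star {H U : ℝ → 𝔄} (B : 𝔄) {S : Set ℝ} {t : ℝ}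
    (hH : IsSelfAdjoint (H t)) (hU : HasDerivWithinAt U (-Complex.I • H t * U t) S t) :
    HasDerivWithinAt (fun r => U r * B * star (U r))
      (-Complex.I • (H t * (U t * B * star (U t)) - U t * B * star (U t) * H t)) S t := by
  refine ((hU.mul_const B).mul hU.star).congr_deriv ?_
  rw [star_mul, star_neg_I_smul hH]
  simp only [smul_mul_assoc, mul_smul_comm, mul_assoc,
    neg_mul, neg_smul, smul_sub, neg_neg]
  module

variable [IsDedekindFiniteMonoid 𝔄]

/-- Growth of a commutator `[A, U B U*]` for a generator `H₁ + H₂` with `[A, H₁] = 0`. -/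
theorem norm_commutator_conj_le {H₁ H₂ U : ℝ → 𝔄} {a b : ℝ}
    (hH₁ : ∀ r ∈ Icc a b, IsSelfAdjoint (H₁ r)) (hH₂ : ∀ r ∈ Icc a b, IsSelfAdjoint (H₂ r))
    (hcont : ContinuousOn H₁ (Icc a b)) (hUa : U a = 1)
    (hU : ∀ r ∈ Icc a b, HasDerivWithinAt U (-Complex.I • (H₁ r + H₂ r) * U r) (Icc a b) r)
    (A B : 𝔄) (hA : ∀ r ∈ Icc a b, Commute A (H₁ r)) {β β' : ℝ → ℝ}
    (hβ : ∀ t, HasDerivAt β (β' t) t) (hβa : β a = 0)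
    (hbound : ∀ r ∈ Icc a b,
      ‖H₂ r * (U r * B * star (U r)) - U r * B * star (U r) * H₂ r‖ ≤ β' r)
    {t : ℝ} (ht : t ∈ Icc a b) :
    ‖A * (U t * B * star (U t)) - U t * B * star (U t) * A‖ ≤
      ‖A * B - B * A‖ + 2 * ‖A‖ * β t := by
  have hab : a ≤ b := ht.1.trans ht.2
  have ha : a ∈ Icc a b := left_mem_Icc.2 hab
  -- `V` is the evolution of `H₁` alone. As `A` commutes with `H₁` at all times, it commutes with
  -- `V`, so conjugation by `V` does not change the norm of a commutator with `A`.
  obtain ⟨V, hVa, hV⟩ := exists_hasDerivWithinAt_of_continuousOn hab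
    (hcont.const_smul (-Complex.I)) a
  have hVu : ∀ r ∈ Icc a b, V r ∈ unitary 𝔄 := fun r hr =>
    mem_unitary_of_hasDerivWithinAt ha (fun r hr => star_neg_I_smul (hH₁ r hr)) hVa hV hr
  have hconst : star (V t) * A * V t = A := by
    have h := Convex.norm_image_sub_le_of_norm_hasDerivWithin_le (C := 0)
      (fun r hr => hasDerivWithinAt_conj (hH₁ r hr) (hV r hr)
        (hasDerivWithinAt_const r (Icc a b) A))
      (fun r hr => by simp [(hA r hr).eq]) (convex_Icc a b) ha ht
    rw [zero_mul, norm_le_zero_iff, sub_eq_zero] at h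
    simpa [hVa] using h
  have hVV : V t * star (V t) = 1 := Unitary.mul_star_self_of_mem (hVu t ht)
  have hAV : A * V t = V t * A := by
    calc A * V t = (V t * star (V t)) * (A * V t) := by rw [hVV, one_mul]
      _ = V t * (star (V t) * A * V t) := by simp only [mul_assoc]
      _ = V t * A := by rw [hconst]
  have hAV' : A * star (V t) = star (V t) * A := by
    calc A * star (V t) = star (V t) * A * V t * star (V t) := by rw [hconst]
      _ = star (V t) * A * (V t * star (V t)) := by simp only [mul_assoc]
      _ = _ := by rw [hVV, mul_one]
  set Q : ℝ → 𝔄 := fun r => U r * B * star (U r) with hQ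
  -- In the picture rotated by `V` the commutator with `H₁` cancels and only the part driven by `H₂`
  -- moves the observable.
  have hg : ∀ r ∈ Icc a b, HasDerivWithinAt (fun r => star (V r) * Q r * V r)
      (star (V r) * (-Complex.I • (H₂ r * Q r - Q r * H₂ r)) * V r) (Icc a b) r := by
    intro r hr
    refine (hasDerivWithinAt_conj (hH₁ r hr) (hV r hr) (hasDerivWithinAt_conj_star
      (H := fun r => H₁ r + H₂ r) B ((hH₁ r hr).add (hH₂ r hr)) (hU r hr))).congr_deriv ?_
    congr 2
    simp only [hQ, add_mul, mul_add, mul_assoc]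
    module
  have hgt := norm_sub_le_of_norm_hasDerivWithinAt_le hg hβ hβa (fun r hr => by
    rw [norm_star_mul_mul_of_mem_unitary (hVu r hr), norm_smul]
    simpa using hbound r hr) ht
  set g := star (V t) * Q t * V t with hgdef
  have hga : star (V a) * Q a * V a = B := by simp [hQ, hVa, hUa]
  rw [hga] at hgt
  have hQg : Q t = V t * g * star (V t) := by
    calc Q t = (V t * star (V t)) * Q t * (V t * star (V t)) := by rw [hVV, one_mul, mul_one]
      _ = _ := by simp only [hgdef, mul_assoc]
  have hcomm : A * Q t - Q t * A = V t * (A * g - g * A) * star (V t) := by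
    rw [hQg]
    calc A * (V t * g * star (V t)) - V t * g * star (V t) * A
        = (A * V t) * g * star (V t) - V t * g * (star (V t) * A) := by simp only [mul_assoc]
      _ = V t * A * g * star (V t) - V t * g * (A * star (V t)) := by rw [hAV, hAV']
      _ = _ := by simp only [mul_sub, sub_mul, mul_assoc]
  calc ‖A * Q t - Q t * A‖ = ‖A * g - g * A‖ := by
        rw [hcomm, norm_mul_mul_star_of_mem_unitary (hVu t ht)]
    _ = ‖(A * B - B * A) + (A * (g - B) - (g - B) * A)‖ := by
        congr 1
        noncomm_ring
    _ ≤ ‖A * B - B * A‖ + ‖A * (g - B) - (g - B) * A‖ := norm_add_le _ _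
    _ ≤ ‖A * B - B * A‖ + 2 * ‖A‖ * ‖g - B‖ := by gcongr; exact norm_commutator_le _ _
    _ ≤ _ := by gcongr

end InteractionPicture

/-! ### Sums over interaction terms controlled by a decay function. -/

section Sums

variable {Γ : Type*} [DecidableEq Γ]

theorem sum_not_disjoint_le (P : Finset (Finset Γ)) (Y : Finset Γ) {g : Finset Γ → ℝ}
    (hg : ∀ Z ∈ P, 0 ≤ g Z) :
    ∑ Z ∈ P with ¬Disjoint Y Z, g Z ≤ ∑ y ∈ Y, ∑ Z ∈ P with y ∈ Z, g Z := by
  simp_rw [Finset.sum_filter]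
  rw [Finset.sum_comm]
  refine Finset.sum_le_sum fun Z hZ => ?_
  have hnn : ∀ y ∈ Y, 0 ≤ if y ∈ Z then g Z else 0 := fun y _ => by
    split_ifs
    · exact hg Z hZ
    · exact le_rfl
  by_cases h : Disjoint Y Z
  · rw [if_neg (not_not.2 h)]
    exact Finset.sum_nonneg hnn
  · rw [if_pos h]
    obtain ⟨y, hy, hyZ⟩ := Finset.not_disjoint_iff.1 h
    calc g Z = if y ∈ Z then g Z else 0 := by rw [if_pos hyZ]
      _ ≤ _ := Finset.single_le_sum hnn hy

variable {P : Finset (Finset Γ)} {φ : Finset Γ → ℝ} {f : Γ → Γ → ℝ} {ψ C : ℝ} {Λ : Finset Γ}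

theorem sum_meet_both_le (hφ : ∀ Z ∈ P, 0 ≤ φ Z)
    (hψ : ∀ x y, ∑ Z ∈ P with x ∈ Z ∧ y ∈ Z, φ Z ≤ ψ * f x y) (Y W : Finset Γ) :
    ∑ Z ∈ P with ¬Disjoint Y Z, φ Z * (if Disjoint Z W then 0 else 1) ≤
      ψ * ∑ y ∈ Y, ∑ w ∈ W, f y w := by
  calc ∑ Z ∈ P with ¬Disjoint Y Z, φ Z * (if Disjoint Z W then 0 else 1)
      ≤ ∑ y ∈ Y, ∑ Z ∈ P with y ∈ Z, φ Z * (if Disjoint Z W then 0 else 1) :=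
        sum_not_disjoint_le P Y fun Z hZ => mul_nonneg (hφ Z hZ) (by split_ifs <;> simp)
    _ = ∑ y ∈ Y, ∑ Z ∈ P.filter (y ∈ ·) with ¬Disjoint W Z, φ Z := by
        refine Finset.sum_congr rfl fun y _ => ?_
        rw [Finset.sum_filter (fun Z => ¬Disjoint W Z)]
        refine Finset.sum_congr rfl fun Z _ => ?_
        by_cases h : Disjoint Z W
        · simp [h, h.symm]
        · simp [h, disjoint_comm.not.1 h]
    _ ≤ ∑ y ∈ Y, ∑ w ∈ W, ∑ Z ∈ P.filter (y ∈ ·) with w ∈ Z, φ Z :=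
        Finset.sum_le_sum fun y _ => sum_not_disjoint_le _ W fun Z hZ =>
          hφ Z (Finset.mem_of_mem_filter Z hZ)
    _ ≤ ∑ y ∈ Y, ∑ w ∈ W, ψ * f y w := by
        refine Finset.sum_le_sum fun y _ => Finset.sum_le_sum fun w _ => ?_
        rw [Finset.filter_filter]
        exact hψ y w
    _ = _ := by simp only [Finset.mul_sum]

/-- One link of a chain from `Y` to `W`: a set `Z` meeting `Y` is charged to pairs `y ∈ Y`, `z ∈ Z`,
and the sum over the intermediate point `z` is absorbed by the convolution property at the price of
`C`. -/
theorem sum_meet_mul_sum_le (hφ : ∀ Z ∈ P, 0 ≤ φ Z) (hP : ∀ Z ∈ P, Z ⊆ Λ)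
    (hf : ∀ x y, 0 ≤ f x y) (hψ0 : 0 ≤ ψ)
    (hψ : ∀ x y, ∑ Z ∈ P with x ∈ Z ∧ y ∈ Z, φ Z ≤ ψ * f x y)
    (hconv : ∀ x y, ∑ z ∈ Λ, f x z * f z y ≤ C * f x y) (Y W : Finset Γ) :
    ∑ Z ∈ P with ¬Disjoint Y Z, φ Z * ∑ z ∈ Z, ∑ w ∈ W, f z w ≤
      ψ * C * ∑ y ∈ Y, ∑ w ∈ W, f y w := by
  calc ∑ Z ∈ P with ¬Disjoint Y Z, φ Z * ∑ z ∈ Z, ∑ w ∈ W, f z w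
      ≤ ∑ y ∈ Y, ∑ Z ∈ P with y ∈ Z, φ Z * ∑ z ∈ Z, ∑ w ∈ W, f z w :=
        sum_not_disjoint_le P Y fun Z hZ => mul_nonneg (hφ Z hZ)
          (Finset.sum_nonneg fun _ _ => Finset.sum_nonneg fun _ _ => hf _ _)
    _ = ∑ y ∈ Y, ∑ z ∈ Λ, (∑ Z ∈ P with y ∈ Z ∧ z ∈ Z, φ Z) * ∑ w ∈ W, f z w := by
        refine Finset.sum_congr rfl fun y _ => ?_
        simp_rw [Finset.sum_mul, Finset.sum_filter]
        rw [Finset.sum_comm]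
        refine Finset.sum_congr rfl fun Z hZ => ?_
        by_cases hy : y ∈ Z
        · simp only [hy, if_true, true_and]
          rw [← Finset.sum_filter, Finset.filter_mem_eq_inter,
            Finset.inter_eq_right.2 (hP Z hZ), Finset.mul_sum]
        · simp [hy]
    _ ≤ ∑ y ∈ Y, ∑ z ∈ Λ, ψ * f y z * ∑ w ∈ W, f z w := by
        refine Finset.sum_le_sum fun y _ => Finset.sum_le_sum fun z _ => ?_
        exact mul_le_mul_of_nonneg_right (hψ y z) (Finset.sum_nonneg fun _ _ => hf _ _)
    _ = ψ * ∑ y ∈ Y, ∑ w ∈ W, ∑ z ∈ Λ, f y z * f z w := by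
        simp_rw [Finset.mul_sum]
        refine Finset.sum_congr rfl fun y _ => ?_
        rw [Finset.sum_comm]
        simp only [mul_assoc]
    _ ≤ ψ * ∑ y ∈ Y, ∑ w ∈ W, C * f y w := by
        gcongr with y _ w _
        exact hconv y w
    _ = _ := by simp only [Finset.mul_sum, mul_assoc]

end Sums

/-! ### The Lieb-Robinson bound and comparison of Heisenberg dynamics. -/

section LiebRobinson

variable {Γ : Type*} [DecidableEq Γ] {𝔄 : Type*} [CStarAlgebra 𝔄]

/-- A finite family of local self-adjoint terms `Φ(Z, r)`, `Z ∈ P`, continuous in `r ∈ [a, b]` and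
bounded by `φ(Z)`, such that the decay of `φ` is controlled by a decay function `f`. -/
structure IsLocalFamily (Loc : Finset Γ → Set 𝔄) (Λ : Finset Γ) (P : Finset (Finset Γ))
    (Φ : Finset Γ → ℝ → 𝔄) (φ : Finset Γ → ℝ) (f : Γ → Γ → ℝ) (ψ C a b : ℝ) : Prop where
  comm : ∀ {Y Z : Finset Γ} {A B : 𝔄}, Disjoint Y Z → A ∈ Loc Y → B ∈ Loc Z → Commute A B
  subset : ∀ Z ∈ P, Z ⊆ Λ
  mem : ∀ Z ∈ P, ∀ r ∈ Icc a b, Φ Z r ∈ Loc Z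
  selfAdjoint : ∀ Z ∈ P, ∀ r ∈ Icc a b, IsSelfAdjoint (Φ Z r)
  continuousOn : ∀ Z ∈ P, ContinuousOn (Φ Z) (Icc a b)
  norm_le : ∀ Z ∈ P, ∀ r ∈ Icc a b, ‖Φ Z r‖ ≤ φ Z
  nonneg : ∀ Z ∈ P, 0 ≤ φ Z
  decay_nonneg : ∀ x y, 0 ≤ f x y
  decay_symm : ∀ x y, f x y = f y x
  strength_nonneg : 0 ≤ ψ
  conv_pos : 0 < C
  strength : ∀ x y, ∑ Z ∈ P with x ∈ Z ∧ y ∈ Z, φ Z ≤ ψ * f x y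
  conv : ∀ x y, ∑ z ∈ Λ, f x z * f z y ≤ C * f x y

namespace IsLocalFamily

variable {Loc : Finset Γ → Set 𝔄} {Λ : Finset Γ} {P : Finset (Finset Γ)}
  {Φ : Finset Γ → ℝ → 𝔄} {φ : Finset Γ → ℝ} {f : Γ → Γ → ℝ} {ψ C a b : ℝ}

/-- Needed because the comparison of dynamics applies the Lieb-Robinson bound to a subfamily, on
intervals restarted at an intermediate time. -/
theorem mono (h : IsLocalFamily Loc Λ P Φ φ f ψ C a b) {P' : Finset (Finset Γ)} (hP : P' ⊆ P)
    {a' b' : ℝ} (hI : Icc a' b' ⊆ Icc a b) : IsLocalFamily Loc Λ P' Φ φ f ψ C a' b' where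
  comm := h.comm
  subset Z hZ := h.subset Z (hP hZ)
  mem Z hZ r hr := h.mem Z (hP hZ) r (hI hr)
  selfAdjoint Z hZ r hr := h.selfAdjoint Z (hP hZ) r (hI hr)
  continuousOn Z hZ := (h.continuousOn Z (hP hZ)).mono hI
  norm_le Z hZ r hr := h.norm_le Z (hP hZ) r (hI hr)
  nonneg Z hZ := h.nonneg Z (hP hZ)
  decay_nonneg := h.decay_nonneg
  decay_symm := h.decay_symm
  strength_nonneg := h.strength_nonneg
  conv_pos := h.conv_pos
  strength x y := (Finset.sum_le_sum_of_subset_of_nonneg (Finset.filter_subset_filter _ hP)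
    fun Z hZ _ => h.nonneg Z (Finset.mem_of_mem_filter Z hZ)).trans (h.strength x y)
  conv := h.conv

theorem isSelfAdjoint_sum (h : IsLocalFamily Loc Λ P Φ φ f ψ C a b) {P' : Finset (Finset Γ)}
    (hP : P' ⊆ P) {r : ℝ} (hr : r ∈ Icc a b) : IsSelfAdjoint (∑ Z ∈ P', Φ Z r) :=
  _root_.isSelfAdjoint_sum P' fun Z hZ => h.selfAdjoint Z (hP hZ) r hr

variable [IsDedekindFiniteMonoid 𝔄]

/-- The Lieb-Robinson bound with the remainder of an iteration of order `n`. -/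
theorem norm_commutator_le_add_remainder (h : IsLocalFamily Loc Λ P Φ φ f ψ C a b)
    {U : ℝ → 𝔄} (hUa : U a = 1)
    (hU : ∀ r ∈ Icc a b,
      HasDerivWithinAt U (-Complex.I • (∑ Z ∈ P, Φ Z r) * U r) (Icc a b) r)
    (hUu : ∀ r ∈ Icc a b, U r ∈ unitary 𝔄)
    {W : Finset Γ} {B : 𝔄} (hB : B ∈ Loc W) (n : ℕ) :
    ∀ {Y : Finset Γ} {A : 𝔄}, A ∈ Loc Y → ∀ {t : ℝ}, t ∈ Icc a b →
    ‖A * (U t * B * star (U t)) - U t * B * star (U t) * A‖ ≤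
      2 * ‖A‖ * ‖B‖ * ((if Disjoint Y W then 0 else 1) +
        C⁻¹ * (Real.exp (2 * ψ * C * (t - a)) - 1) * (∑ y ∈ Y, ∑ w ∈ W, f y w) +
        (2 * (∑ Z ∈ P, φ Z) * (t - a)) ^ n / n.factorial) := by
  have hexp : ∀ {t : ℝ}, t ∈ Icc a b → 0 ≤ C⁻¹ * (Real.exp (2 * ψ * C * (t - a)) - 1) := by
    intro t ht
    have : 0 ≤ 2 * ψ * C * (t - a) :=
      mul_nonneg (mul_nonneg (mul_nonneg zero_le_two h.strength_nonneg) h.conv_pos.le)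
        (sub_nonneg.2 ht.1)
    exact mul_nonneg (inv_nonneg.2 h.conv_pos.le) (sub_nonneg.2 (Real.one_le_exp this))
  have hD : ∀ Y : Finset Γ, 0 ≤ ∑ y ∈ Y, ∑ w ∈ W, f y w := fun Y =>
    Finset.sum_nonneg fun _ _ => Finset.sum_nonneg fun _ _ => h.decay_nonneg _ _
  have hM : 0 ≤ ∑ Z ∈ P, φ Z := Finset.sum_nonneg h.nonneg
  induction n with
  | zero =>
    intro Y A _ t ht
    calc ‖A * (U t * B * star (U t)) - U t * B * star (U t) * A‖
        ≤ 2 * ‖A‖ * ‖U t * B * star (U t)‖ := norm_commutator_le _ _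
      _ = 2 * ‖A‖ * ‖B‖ * (0 + 0 + 1) := by
          rw [norm_mul_mul_star_of_mem_unitary (hUu t ht)]; ring
      _ ≤ _ := by
          have := mul_nonneg (hexp ht) (hD Y)
          simp only [pow_zero, Nat.factorial_zero, Nat.cast_one, div_one]
          gcongr
          split_ifs <;> simp
  | succ n ih =>
    intro Y A hA t ht
    set D := ∑ y ∈ Y, ∑ w ∈ W, f y w with hDdef
    set M := ∑ Z ∈ P, φ Z with hMdef
    set v := 2 * ψ * C with hv
    -- The terms in `P₁` commute with `A`, so only those in `P₂` make the commutator grow. The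
    -- induction hypothesis is applied with each of these terms in the role of `A`.
    let P₁ := P.filter fun Z => Disjoint Y Z
    let P₂ := P.filter fun Z => ¬Disjoint Y Z
    have hP₁ : P₁ ⊆ P := Finset.filter_subset _ _
    have hP₂ : P₂ ⊆ P := Finset.filter_subset _ _
    have hsplit : ∀ r, ∑ Z ∈ P, Φ Z r = ∑ Z ∈ P₁, Φ Z r + ∑ Z ∈ P₂, Φ Z r := fun r =>
      (Finset.sum_filter_add_sum_filter_not P _ _).symm
    -- The primitive of `β'` vanishing at `a`. In the form `(2 * C)⁻¹ * (exp - 1)` the division by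
    -- `ψ` has already cancelled, so `ψ = 0` needs no separate treatment.
    let β : ℝ → ℝ := fun t => 2 * ‖B‖ * ((2 * C)⁻¹ * (Real.exp (v * (t - a)) - 1) * D +
      2⁻¹ * ((2 * M * (t - a)) ^ (n + 1) / (n + 1).factorial))
    let β' : ℝ → ℝ := fun t => 2 * ‖B‖ * (ψ * Real.exp (v * (t - a)) * D +
      M * ((2 * M * (t - a)) ^ n / n.factorial))
    have hβ : ∀ t, HasDerivAt β (β' t) t := by
      intro t
      have h1 : HasDerivAt (fun t => v * (t - a)) v t := by
        simpa using ((hasDerivAt_id t).sub_const a).const_mul v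
      have h2 : HasDerivAt (fun t => 2 * M * (t - a)) (2 * M) t := by
        simpa using ((hasDerivAt_id t).sub_const a).const_mul (2 * M)
      refine (((((h1.exp.sub_const 1).const_mul (2 * C)⁻¹).mul_const D).add
        (((h2.pow (n + 1)).div_const ((n + 1).factorial : ℝ)).const_mul 2⁻¹)).const_mul
          (2 * ‖B‖)).congr_deriv ?_
      have hC := h.conv_pos.ne'
      simp only [β', hv, Nat.factorial_succ, Nat.add_sub_cancel]
      push_cast
      field_simp
    have hβa : β a = 0 := by simp [β]
    have hbound : ∀ r ∈ Icc a b, ‖(∑ Z ∈ P₂, Φ Z r) * (U r * B * star (U r)) -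
        U r * B * star (U r) * ∑ Z ∈ P₂, Φ Z r‖ ≤ β' r := by
      intro r hr
      have hR : 0 ≤ (2 * M * (r - a)) ^ n / n.factorial := by
        have := sub_nonneg.2 hr.1
        positivity
      rw [Finset.sum_mul, Finset.mul_sum, ← Finset.sum_sub_distrib]
      calc _ ≤ ∑ Z ∈ P₂, ‖Φ Z r * (U r * B * star (U r)) - U r * B * star (U r) * Φ Z r‖ :=
            norm_sum_le _ _
        _ ≤ ∑ Z ∈ P₂, 2 * φ Z * ‖B‖ * ((if Disjoint Z W then 0 else 1) +
              C⁻¹ * (Real.exp (v * (r - a)) - 1) * (∑ y ∈ Z, ∑ w ∈ W, f y w) +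
              (2 * M * (r - a)) ^ n / n.factorial) := by
            refine Finset.sum_le_sum fun Z hZ => ?_
            refine (ih (h.mem Z (hP₂ hZ) r hr) hr).trans ?_
            have h0 : 0 ≤ (if Disjoint Z W then (0 : ℝ) else 1) +
              C⁻¹ * (Real.exp (v * (r - a)) - 1) * (∑ y ∈ Z, ∑ w ∈ W, f y w) +
              (2 * M * (r - a)) ^ n / n.factorial := by
              have := mul_nonneg (hexp hr) (hD Z)
              refine add_nonneg (add_nonneg (by split_ifs <;> simp) this) hR
            gcongr
            exact h.norm_le Z (hP₂ hZ) r hr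
        _ = 2 * ‖B‖ * (∑ Z ∈ P₂, φ Z * (if Disjoint Z W then 0 else 1) +
              C⁻¹ * (Real.exp (v * (r - a)) - 1) * ∑ Z ∈ P₂, φ Z * ∑ y ∈ Z, ∑ w ∈ W, f y w +
              (∑ Z ∈ P₂, φ Z) * ((2 * M * (r - a)) ^ n / n.factorial)) := by
            generalize (2 * M * (r - a)) ^ n / (n.factorial : ℝ) = R
            rw [Finset.mul_sum, Finset.sum_mul, ← Finset.sum_add_distrib,
              ← Finset.sum_add_distrib, Finset.mul_sum]
            refine Finset.sum_congr rfl fun Z _ => ?_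
            ring
        -- The claimed bound is a fixed point of the iteration: the direct hits give `ψ D`, the
        -- chains give `ψ (exp - 1) D`, and together they make `ψ exp D`, the derivative of the next
        -- exponential bound up to constants.
        _ ≤ 2 * ‖B‖ * (ψ * D + C⁻¹ * (Real.exp (v * (r - a)) - 1) * (ψ * C * D) +
              M * ((2 * M * (r - a)) ^ n / n.factorial)) := by
            have e := hexp hr
            have h1 := sum_meet_both_le h.nonneg h.strength Y W
            have h2 := sum_meet_mul_sum_le h.nonneg h.subset h.decay_nonneg h.strength_nonneg
              h.strength h.conv Y W
            have h3 : ∑ Z ∈ P₂, φ Z ≤ M :=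
              Finset.sum_le_sum_of_subset_of_nonneg hP₂ fun Z hZ _ => h.nonneg Z hZ
            gcongr
        _ = _ := by
            have hC := h.conv_pos.ne'
            simp only [β']
            field_simp
            ring
    have hmain := norm_commutator_conj_le (H₁ := fun r => ∑ Z ∈ P₁, Φ Z r)
      (H₂ := fun r => ∑ Z ∈ P₂, Φ Z r)
      (fun r hr => h.isSelfAdjoint_sum hP₁ hr) (fun r hr => h.isSelfAdjoint_sum hP₂ hr)
      (continuousOn_finsetSum _ fun Z hZ => h.continuousOn Z (hP₁ hZ)) hUa
      (fun r hr => by simpa only [hsplit r] using hU r hr) A B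
      (fun r hr => Commute.sum_right _ _ _ fun Z hZ =>
        h.comm (Finset.mem_filter.1 hZ).2 hA (h.mem Z (hP₁ hZ) r hr)) hβ hβa hbound ht
    have hAB : ‖A * B - B * A‖ ≤ 2 * ‖A‖ * ‖B‖ * (if Disjoint Y W then 0 else 1) := by
      split_ifs with hd
      · rw [(h.comm hd hA hB).eq]; simp
      · rw [mul_one]; exact norm_commutator_le _ _
    refine hmain.trans ((add_le_add_left hAB _).trans (le_of_eq ?_))
    simp only [β]
    have hC := h.conv_pos.ne'
    field_simp
    ring

/-- The Lieb-Robinson bound. -/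
theorem lieb_robinson (h : IsLocalFamily Loc Λ P Φ φ f ψ C a b)
    {U : ℝ → 𝔄} (hUa : U a = 1)
    (hU : ∀ r ∈ Icc a b,
      HasDerivWithinAt U (-Complex.I • (∑ Z ∈ P, Φ Z r) * U r) (Icc a b) r)
    (hUu : ∀ r ∈ Icc a b, U r ∈ unitary 𝔄)
    {W Y : Finset Γ} {A B : 𝔄} (hB : B ∈ Loc W) (hA : A ∈ Loc Y) {t : ℝ} (ht : t ∈ Icc a b) :
    ‖A * (U t * B * star (U t)) - U t * B * star (U t) * A‖ ≤
      2 * ‖A‖ * ‖B‖ * ((if Disjoint Y W then 0 else 1) +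
        C⁻¹ * (Real.exp (2 * ψ * C * (t - a)) - 1) * (∑ y ∈ Y, ∑ w ∈ W, f y w)) := by
  refine ge_of_tendsto' (x := atTop)
    (f := fun n : ℕ => 2 * ‖A‖ * ‖B‖ * ((if Disjoint Y W then 0 else 1) +
        C⁻¹ * (Real.exp (2 * ψ * C * (t - a)) - 1) * (∑ y ∈ Y, ∑ w ∈ W, f y w) +
        (2 * (∑ Z ∈ P, φ Z) * (t - a)) ^ n / n.factorial)) ?_
    fun n => h.norm_commutator_le_add_remainder hUa hU hUu hB n hA ht
  have := ((FloorSemiring.tendsto_pow_div_factorial_atTop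
    (2 * (∑ Z ∈ P, φ Z) * (t - a))).const_add ((if Disjoint Y W then (0 : ℝ) else 1) +
        C⁻¹ * (Real.exp (2 * ψ * C * (t - a)) - 1) * (∑ y ∈ Y, ∑ w ∈ W, f y w))).const_mul
    (2 * ‖A‖ * ‖B‖)
  rwa [add_zero] at this

/-- Comparison of the Heisenberg dynamics generated by all terms of the family and by the terms
supported in `Λ'`. -/
theorem norm_heisenberg_sub_le (h : IsLocalFamily Loc Λ P Φ φ f ψ C a b) (hab : a ≤ b)
    (Λ' : Finset Γ) {U U' : ℝ → 𝔄} (hUa : U a = 1) (hUa' : U' a = 1)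
    (hU : ∀ r ∈ Icc a b,
      HasDerivWithinAt U (-Complex.I • (∑ Z ∈ P, Φ Z r) * U r) (Icc a b) r)
    (hU' : ∀ r ∈ Icc a b,
      HasDerivWithinAt U' (-Complex.I • (∑ Z ∈ P with Z ⊆ Λ', Φ Z r) * U' r) (Icc a b) r)
    {Y : Finset Γ} {A : 𝔄} (hA : A ∈ Loc Y) :
    ‖star (U b) * A * U b - star (U' b) * A * U' b‖ ≤
      ‖A‖ * C⁻¹ * (Real.exp (2 * ψ * C * (b - a)) - 1) * ∑ y ∈ Y, ∑ w ∈ Λ \ Λ', f y w := by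
  set P' := P.filter (· ⊆ Λ') with hP'def
  have hP' : P' ⊆ P := Finset.filter_subset _ _
  let P'' := P.filter fun Z => ¬Z ⊆ Λ'
  have hP'' : P'' ⊆ P := Finset.filter_subset _ _
  have ha : a ∈ Icc a b := left_mem_Icc.2 hab
  have hb : b ∈ Icc a b := right_mem_Icc.2 hab
  have hUu : ∀ r ∈ Icc a b, U r ∈ unitary 𝔄 := fun r hr =>
    mem_unitary_of_hasDerivWithinAt ha (fun r hr => star_neg_I_smul
      (h.isSelfAdjoint_sum subset_rfl hr)) hUa hU hr
  have hUu' : ∀ r ∈ Icc a b, U' r ∈ unitary 𝔄 := fun r hr =>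
    mem_unitary_of_hasDerivWithinAt ha (fun r hr => star_neg_I_smul
      (h.isSelfAdjoint_sum hP' hr)) hUa' hU' hr
  set v := 2 * ψ * C with hv
  set D := ∑ y ∈ Y, ∑ w ∈ Λ \ Λ', f y w with hD
  have hDsymm : D = ∑ w ∈ Λ \ Λ', ∑ y ∈ Y, f w y := by
    rw [hD, Finset.sum_comm]
    exact Finset.sum_congr rfl fun _ _ => Finset.sum_congr rfl fun _ _ => h.decay_symm _ _
  -- `A` is evolved by `U'` over the whole interval, then undone up to time `r` in `Q r`. Hence
  -- `star (U r) * Q r * U r` interpolates between the `U'`-evolved observable at `a` and the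
  -- `U`-evolved one at `b`.
  set E := star (U' b) * A * U' b with hE
  have hEn : ‖E‖ = ‖A‖ := norm_star_mul_mul_of_mem_unitary (hUu' b hb) A
  set Q : ℝ → 𝔄 := fun r => U' r * E * star (U' r) with hQ
  have hbound : ∀ r ∈ Icc a b, ‖(∑ Z ∈ P'', Φ Z r) * Q r - Q r * ∑ Z ∈ P'', Φ Z r‖ ≤
      2 * ‖A‖ * ψ * Real.exp (v * (b - r)) * D := by
    intro r hr
    have hI : Icc r b ⊆ Icc a b := Icc_subset_Icc_left hr.1
    have hrb : b ∈ Icc r b := right_mem_Icc.2 hr.2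
    have e : 0 ≤ C⁻¹ * (Real.exp (v * (b - r)) - 1) := by
      have : 0 ≤ v * (b - r) :=
        mul_nonneg (mul_nonneg (mul_nonneg zero_le_two h.strength_nonneg) h.conv_pos.le)
          (sub_nonneg.2 hr.2)
      exact mul_nonneg (inv_nonneg.2 h.conv_pos.le) (sub_nonneg.2 (Real.one_le_exp this))
    have hWu : ∀ q ∈ Icc r b, U' q * star (U' r) ∈ unitary 𝔄 := fun q hq =>
      mul_mem (hUu' q (hI hq)) (Unitary.star_mem (hUu' r hr))
    have hterm : ∀ Z ∈ P'', ‖Φ Z r * Q r - Q r * Φ Z r‖ ≤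
        2 * ‖A‖ * φ Z * ((if Disjoint Z Y then 0 else 1) +
          C⁻¹ * (Real.exp (v * (b - r)) - 1) * (∑ z ∈ Z, ∑ y ∈ Y, f z y)) := by
      intro Z hZ
      -- `U' q * star (U' r)` is the restricted evolution started at time `r`, which yields the
      -- bound with elapsed time `b - r`.
      have hlr := (h.mono hP' hI).lieb_robinson (U := fun q => U' q * star (U' r))
        (Unitary.mul_star_self_of_mem (hUu' r hr))
        (fun q hq => (((hU' q (hI hq)).mono hI).mul_const (star (U' r))).congr_deriv
          (mul_assoc _ _ _)) hWu (h.mem Z (hP'' hZ) r hr) hA hrb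
      set V := U' b * star (U' r) with hV
      have hVu : V ∈ unitary 𝔄 := hWu b hrb
      have hVV : star V * V = 1 := Unitary.star_mul_self_of_mem hVu
      have hQV : Q r = star V * A * V := by
        simp only [hQ, hE, hV, star_mul, star_star, mul_assoc]
      -- Conjugation by `V` moves the evolution from `A` to `Φ Z r`, matching the order of
      -- conjugation in the Lieb-Robinson bound.
      have hcomm : Φ Z r * Q r - Q r * Φ Z r =
          -(star V * (A * (V * Φ Z r * star V) - V * Φ Z r * star V * A) * V) := by
        calc Φ Z r * Q r - Q r * Φ Z r
            = (star V * V) * Φ Z r * star V * A * V - star V * A * V * Φ Z r * (star V * V) := by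
              rw [hVV, hQV]; noncomm_ring
          _ = _ := by noncomm_ring
      rw [hcomm, norm_neg, norm_star_mul_mul_of_mem_unitary hVu]
      refine hlr.trans ?_
      have hs : ∑ y ∈ Y, ∑ w ∈ Z, f y w = ∑ z ∈ Z, ∑ y ∈ Y, f z y := by
        rw [Finset.sum_comm]
        exact Finset.sum_congr rfl fun _ _ => Finset.sum_congr rfl fun _ _ => h.decay_symm _ _
      rw [hs]
      have h0 : 0 ≤ (if Disjoint Z Y then (0 : ℝ) else 1) +
          C⁻¹ * (Real.exp (v * (b - r)) - 1) * (∑ z ∈ Z, ∑ y ∈ Y, f z y) :=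
        add_nonneg (by split_ifs <;> simp) (mul_nonneg e
          (Finset.sum_nonneg fun _ _ => Finset.sum_nonneg fun _ _ => h.decay_nonneg _ _))
      simp only [disjoint_comm (a := Y) (b := Z)]
      gcongr
      exact h.norm_le Z (hP'' hZ) r hr
    -- A term not supported in `Λ'` meets `Λ \ Λ'`; the sum over chains can therefore start from
    -- that set.
    have hsub : P'' ⊆ P.filter fun Z => ¬Disjoint (Λ \ Λ') Z := by
      intro Z hZ
      obtain ⟨hZP, hZΛ⟩ := Finset.mem_filter.1 hZ
      obtain ⟨z, hz, hzΛ⟩ := Finset.not_subset.1 hZΛ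
      exact Finset.mem_filter.2 ⟨hZP, Finset.not_disjoint_iff.2
        ⟨z, Finset.mem_sdiff.2 ⟨h.subset Z hZP hz, hzΛ⟩, hz⟩⟩
    rw [Finset.sum_mul, Finset.mul_sum, ← Finset.sum_sub_distrib]
    calc _ ≤ ∑ Z ∈ P'', ‖Φ Z r * Q r - Q r * Φ Z r‖ := norm_sum_le _ _
      _ ≤ _ := Finset.sum_le_sum hterm
      _ ≤ ∑ Z ∈ P with ¬Disjoint (Λ \ Λ') Z, 2 * ‖A‖ * φ Z * ((if Disjoint Z Y then 0 else 1) +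
          C⁻¹ * (Real.exp (v * (b - r)) - 1) * (∑ z ∈ Z, ∑ y ∈ Y, f z y)) := by
          refine Finset.sum_le_sum_of_subset_of_nonneg hsub fun Z hZ _ => ?_
          have := h.nonneg Z (Finset.mem_of_mem_filter Z hZ)
          exact mul_nonneg (by positivity) (add_nonneg (by split_ifs <;> simp) (mul_nonneg e
            (Finset.sum_nonneg fun _ _ => Finset.sum_nonneg fun _ _ => h.decay_nonneg _ _)))
      _ = 2 * ‖A‖ * (∑ Z ∈ P with ¬Disjoint (Λ \ Λ') Z, φ Z * (if Disjoint Z Y then 0 else 1) +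
            C⁻¹ * (Real.exp (v * (b - r)) - 1) *
              ∑ Z ∈ P with ¬Disjoint (Λ \ Λ') Z, φ Z * ∑ z ∈ Z, ∑ y ∈ Y, f z y) := by
          rw [Finset.mul_sum, ← Finset.sum_add_distrib, Finset.mul_sum]
          refine Finset.sum_congr rfl fun Z _ => ?_
          ring
      _ ≤ 2 * ‖A‖ * (ψ * D + C⁻¹ * (Real.exp (v * (b - r)) - 1) * (ψ * C * D)) := by
          have h1 := sum_meet_both_le h.nonneg h.strength (Λ \ Λ') Y
          have h2 := sum_meet_mul_sum_le h.nonneg h.subset h.decay_nonneg h.strength_nonneg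
            h.strength h.conv (Λ \ Λ') Y
          rw [← hDsymm] at h1 h2
          gcongr
      _ = _ := by
          have hC := h.conv_pos.ne'
          field_simp
          ring
  have hN : ∀ r ∈ Icc a b, HasDerivWithinAt (fun r => star (U r) * Q r * U r)
      (star (U r) * (Complex.I • ((∑ Z ∈ P'', Φ Z r) * Q r - Q r * ∑ Z ∈ P'', Φ Z r)) * U r)
      (Icc a b) r := by
    intro r hr
    refine (hasDerivWithinAt_conj (H := fun r => ∑ Z ∈ P, Φ Z r)
      (h.isSelfAdjoint_sum subset_rfl hr) (hU r hr)
      (hasDerivWithinAt_conj_star (H := fun r => ∑ Z ∈ P', Φ Z r) E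
        (h.isSelfAdjoint_sum hP' hr) (hU' r hr))).congr_deriv ?_
    congr 2
    have hsplit : ∑ Z ∈ P, Φ Z r = ∑ Z ∈ P', Φ Z r + ∑ Z ∈ P'', Φ Z r :=
      (Finset.sum_filter_add_sum_filter_not P _ _).symm
    simp only [hsplit, hQ, add_mul, mul_add]
    module
  have hβ : ∀ t, HasDerivAt
      (fun t => ‖A‖ * C⁻¹ * D * (Real.exp (v * (b - a)) - Real.exp (v * (b - t))))
      (2 * ‖A‖ * ψ * Real.exp (v * (b - t)) * D) t := by
    intro t
    have h1 : HasDerivAt (fun t => v * (b - t)) (-v) t := by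
      simpa using ((hasDerivAt_id t).const_sub b).const_mul v
    refine ((h1.exp.const_sub (Real.exp (v * (b - a)))).const_mul (‖A‖ * C⁻¹ * D)).congr_deriv ?_
    have hC := h.conv_pos.ne'
    rw [hv]
    field_simp
  have hfin := norm_sub_le_of_norm_hasDerivWithinAt_le hN hβ (by simp) (fun r hr => by
    rw [norm_star_mul_mul_of_mem_unitary (hUu r hr), norm_smul]
    simpa using hbound r hr) hb
  have hQa : star (U a) * Q a * U a = E := by simp [hQ, hUa, hUa']
  have hQb : Q b = A := by
    have hbb : U' b * star (U' b) = 1 := Unitary.mul_star_self_of_mem (hUu' b hb)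
    calc Q b = (U' b * star (U' b)) * A * (U' b * star (U' b)) := by
          simp only [hQ, hE, mul_assoc]
      _ = A := by rw [hbb, one_mul, mul_one]
  simp only [hQa, hQb, sub_self, mul_zero, Real.exp_zero] at hfin
  refine hfin.trans (le_of_eq ?_)
  ring

end IsLocalFamily

end LiebRobinson

/-! ### Tensor products and embeddings of local algebras. -/

section Embedding

open scoped Kronecker

variable {Γ : Type*} [DecidableEq Γ] {ι : Γ → Type*}

/-- Configurations on `Λ` as pairs of configurations on `Y ⊆ Λ` and on `Λ \ Y`. -/
def cfgEquiv {Y Λ : Finset Γ} (h : Y ⊆ Λ) : Cfg ι Λ ≃ Cfg ι Y × Cfg ι (Λ \ Y) where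
  toFun η := (Finset.restrict₂ h η, Finset.restrict₂ Finset.sdiff_subset η)
  invFun p x := if hx : x.1 ∈ Y then p.1 ⟨x, hx⟩ else p.2 ⟨x, Finset.mem_sdiff.2 ⟨x.2, hx⟩⟩
  left_inv η := by
    ext x
    by_cases hx : x.1 ∈ Y <;> simp [hx]
  right_inv p := by
    ext x
    · simp
    · simp [(Finset.mem_sdiff.1 x.2).2]

variable [∀ x, Fintype (ι x)] [∀ x, DecidableEq (ι x)]

omit [∀ x, Fintype (ι x)] [∀ x, DecidableEq (ι x)] in
theorem tensor_eq_submatrix {Y Λ : Finset Γ} (h : Y ⊆ Λ) (A : Obs ι Y) (B : Obs ι (Λ \ Y)) :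
    tensor h A B = (A ⊗ₖ B).submatrix (cfgEquiv h) (cfgEquiv h) := rfl

omit [∀ x, DecidableEq (ι x)] in
theorem tensor_mul_tensor {Y Λ : Finset Γ} (h : Y ⊆ Λ) (A A' : Obs ι Y) (B B' : Obs ι (Λ \ Y)) :
    tensor h A B * tensor h A' B' = tensor h (A * A') (B * B') := by
  simp only [tensor_eq_submatrix, Matrix.mul_kronecker_mul, Matrix.submatrix_mul_equiv]

omit [∀ x, Fintype (ι x)] in
theorem tensor_one_one {Y Λ : Finset Γ} (h : Y ⊆ Λ) :
    tensor h (1 : Obs ι Y) (1 : Obs ι (Λ \ Y)) = 1 := by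
  rw [tensor_eq_submatrix, Matrix.one_kronecker_one, Matrix.submatrix_one_equiv]

omit [∀ x, Fintype (ι x)] [∀ x, DecidableEq (ι x)] in
theorem star_tensor {Y Λ : Finset Γ} (h : Y ⊆ Λ) (A : Obs ι Y) (B : Obs ι (Λ \ Y)) :
    star (tensor h A B) = tensor h (star A) (star B) := by
  ext η η'
  simp [tensor, Matrix.star_apply]

/-- The embedding `A ↦ A ⊗ 1` as a homomorphism of star algebras. -/
def embedHom {Y Λ : Finset Γ} (h : Y ⊆ Λ) : Obs ι Y →⋆ₐ[ℂ] Obs ι Λ where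
  toFun A := tensor h A 1
  map_one' := tensor_one_one h
  map_mul' A A' := by rw [tensor_mul_tensor, mul_one]
  map_zero' := by ext; simp [tensor]
  map_add' A A' := by ext; simp [tensor, add_mul]
  commutes' c := by
    rw [Algebra.algebraMap_eq_smul_one, Algebra.algebraMap_eq_smul_one, ← tensor_one_one h]
    ext
    simp [tensor, mul_assoc]
  map_star' A := by rw [star_tensor, star_one]

theorem embed_eq_embedHom {Y Λ : Finset Γ} (h : Y ⊆ Λ) (A : Obs ι Y) :
    embed Λ A = embedHom h A := by
  rw [embed, dif_pos h]
  rfl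

-- This entrywise form makes transitivity of the embeddings a comparison of conditions on
-- coordinates, without identifying iterated tensor products.
omit [∀ x, Fintype (ι x)] in
theorem embed_apply {Y Λ : Finset Γ} (h : Y ⊆ Λ) (A : Obs ι Y) (η η' : Cfg ι Λ) :
    embed Λ A η η' = if ∀ x : Λ, x.1 ∉ Y → η x = η' x then
      A (Finset.restrict₂ h η) (Finset.restrict₂ h η') else 0 := by
  have : Finset.restrict₂ (π := ι) (Finset.sdiff_subset (s := Λ) (t := Y)) η =
      Finset.restrict₂ Finset.sdiff_subset η' ↔ ∀ x : Λ, x.1 ∉ Y → η x = η' x := by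
    refine ⟨fun h x hx => congrFun h ⟨x, Finset.mem_sdiff.2 ⟨x.2, hx⟩⟩, fun h => ?_⟩
    ext x
    exact h ⟨x, Finset.sdiff_subset x.2⟩ (Finset.mem_sdiff.1 x.2).2
  simp only [embed, dif_pos h, tensor, Matrix.of_apply, Matrix.one_apply, this, mul_ite, mul_one,
    mul_zero]

omit [∀ x, Fintype (ι x)] in
theorem embed_embed {Y Y' Λ : Finset Γ} (h : Y ⊆ Y') (h' : Y' ⊆ Λ) (A : Obs ι Y) :
    embed Λ (embed Y' A) = embed Λ A := by
  ext η η'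
  rw [embed_apply h', embed_apply h, embed_apply (h.trans h')]
  by_cases h1 : ∀ x : Λ, x.1 ∉ Y' → η x = η' x
  · rw [if_pos h1]
    refine if_congr ⟨fun h2 x hx => ?_, fun h2 x hx => h2 ⟨x, h' x.2⟩ hx⟩ rfl rfl
    by_cases hx' : x.1 ∈ Y'
    · exact h2 ⟨x, hx'⟩ hx
    · exact h1 x hx'
  · rw [if_neg h1, if_neg fun h2 => h1 fun x hx => h2 x fun hxY => hx (h hxY)]

omit [∀ x, Fintype (ι x)] in
theorem tensor_one_left {Y Λ : Finset Γ} (h : Y ⊆ Λ) (B : Obs ι (Λ \ Y)) :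
    tensor h 1 B = embed Λ B := by
  ext η η'
  rw [embed_apply Finset.sdiff_subset]
  have : Finset.restrict₂ (π := ι) h η = Finset.restrict₂ h η' ↔
      ∀ x : Λ, x.1 ∉ Λ \ Y → η x = η' x := by
    refine ⟨fun h2 x hx => ?_, fun h2 => ?_⟩
    · have hxY : x.1 ∈ Y := by
        by_contra hxY
        exact hx (Finset.mem_sdiff.2 ⟨x.2, hxY⟩)
      exact congrFun h2 ⟨x, hxY⟩
    · ext x
      exact h2 ⟨x, h x.2⟩ fun hx => (Finset.mem_sdiff.1 hx).2 x.2
  simp only [tensor, Matrix.of_apply, Matrix.one_apply, this, ite_mul, one_mul, zero_mul]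

theorem tensor_eq_embed_mul_embed {Y Λ : Finset Γ} (h : Y ⊆ Λ) (A : Obs ι Y)
    (B : Obs ι (Λ \ Y)) : tensor h A B = embed Λ A * embed Λ B := by
  rw [← tensor_one_left h, embed, dif_pos h, tensor_mul_tensor, mul_one, one_mul]

theorem commute_embed {Y Z Λ : Finset Γ} (h : Disjoint Y Z) (hY : Y ⊆ Λ) (hZ : Z ⊆ Λ)
    (A : Obs ι Y) (B : Obs ι Z) : Commute (embed Λ A) (embed Λ B) := by
  have hZ' : Z ⊆ Λ \ Y := fun z hz =>
    Finset.mem_sdiff.2 ⟨hZ hz, fun hzY => Finset.disjoint_left.1 h hzY hz⟩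
  rw [← embed_embed hZ' Finset.sdiff_subset B, ← tensor_one_left hY, embed, dif_pos hY]
  rw [Commute, SemiconjBy, tensor_mul_tensor, tensor_mul_tensor, mul_one, one_mul, one_mul,
    mul_one]

/-- Homomorphisms of C*-algebras are contractive, so the operator norm of a tensor product need not
be computed. -/
theorem norm_embed_le {Y Λ : Finset Γ} (h : Y ⊆ Λ) (A : Obs ι Y) : ‖embed Λ A‖ ≤ ‖A‖ := by
  rw [embed_eq_embedHom h]
  exact NonUnitalStarAlgHom.norm_apply_le (embedHom h) A

theorem hasDerivWithinAt_embed {Y Λ : Finset Γ} (h : Y ⊆ Λ) {U : ℝ → Obs ι Y} {U' : Obs ι Y}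
    {S : Set ℝ} {t : ℝ} (hU : HasDerivWithinAt U U' S t) :
    HasDerivWithinAt (fun r => embed Λ (U r)) (embed Λ U') S t := by
  simp only [embed_eq_embedHom h]
  let L := ((embedHom (ι := ι) h).toAlgHom.toLinearMap.restrictScalars ℝ).toContinuousLinearMap
  exact L.hasFDerivAt.comp_hasDerivWithinAt t hU

theorem continuousOn_embed {Y Λ : Finset Γ} (h : Y ⊆ Λ) {U : ℝ → Obs ι Y}
    {S : Set ℝ} (hU : ContinuousOn U S) : ContinuousOn (fun r => embed Λ (U r)) S := by
  simp only [embed_eq_embedHom h]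
  exact (embedHom (ι := ι) h).toAlgHom.toLinearMap.continuous_of_finiteDimensional.comp_continuousOn
    hU

theorem embed_mul {Y Λ : Finset Γ} (h : Y ⊆ Λ) (A B : Obs ι Y) :
    embed Λ (A * B) = embed Λ A * embed Λ B := by
  simp only [embed_eq_embedHom h, map_mul]

theorem embed_star {Y Λ : Finset Γ} (h : Y ⊆ Λ) (A : Obs ι Y) :
    embed Λ (star A) = star (embed Λ A) := by
  simp only [embed_eq_embedHom h, map_star]

theorem embed_smul {Y Λ : Finset Γ} (h : Y ⊆ Λ) (c : ℂ) (A : Obs ι Y) :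
    embed Λ (c • A) = c • embed Λ A := by
  simp only [embed_eq_embedHom h, map_smul]

theorem embed_sum {Y Λ : Finset Γ} (h : Y ⊆ Λ) {κ : Type*} (s : Finset κ) (A : κ → Obs ι Y) :
    embed Λ (∑ k ∈ s, A k) = ∑ k ∈ s, embed Λ (A k) := by
  simp only [embed_eq_embedHom h, map_sum]

theorem embed_one {Y Λ : Finset Γ} (h : Y ⊆ Λ) : embed Λ (1 : Obs ι Y) = 1 := by
  simp only [embed_eq_embedHom h, map_one]

theorem embed_zero {Y Λ : Finset Γ} (h : Y ⊆ Λ) : embed Λ (0 : Obs ι Y) = 0 := by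
  simp only [embed_eq_embedHom h, map_zero]

theorem embed_mem_unitary {Y Λ : Finset Γ} (h : Y ⊆ Λ) {U : Obs ι Y}
    (hU : U ∈ unitary (Obs ι Y)) : embed Λ U ∈ unitary (Obs ι Λ) := by
  rw [embed_eq_embedHom h]
  exact Unitary.map_mem (embedHom h) hU

theorem isSelfAdjoint_embed {Y : Finset Γ} (Λ : Finset Γ) {A : Obs ι Y} (hA : IsSelfAdjoint A) :
    IsSelfAdjoint (embed Λ A) := by
  by_cases h : Y ⊆ Λ
  · rw [embed_eq_embedHom h]
    exact hA.map (embedHom h)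
  · rw [embed, dif_neg h]
    exact .zero _

end Embedding

/-! ### Duhamel comparison of an evolution with an approximate factorisation. -/

section Comparison

variable {𝔄 : Type*} [CStarAlgebra 𝔄]

/-- Comparison of a unitary evolution `U` with a product `V E*`, where `E` approximately generates
the interaction picture of `U` relative to `V`. -/
theorem norm_sub_mul_star_le {H K G U V E : ℝ → 𝔄} {s t c : ℝ}
    (hH : ∀ r ∈ uIcc s t, IsSelfAdjoint (H r)) (hG : ∀ r ∈ uIcc s t, IsSelfAdjoint (G r))
    (hUs : U s = 1) (hVs : V s = 1) (hEs : E s = 1)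
    (hU : ∀ r ∈ uIcc s t, HasDerivWithinAt U (-Complex.I • H r * U r) (uIcc s t) r)
    (hV : ∀ r ∈ uIcc s t, HasDerivWithinAt V (-Complex.I • K r * V r) (uIcc s t) r)
    (hE : ∀ r ∈ uIcc s t, HasDerivWithinAt E (Complex.I • G r * E r) (uIcc s t) r)
    (hUu : ∀ r ∈ uIcc s t, U r ∈ unitary 𝔄) (hVu : ∀ r ∈ uIcc s t, V r ∈ unitary 𝔄)
    (hEu : ∀ r ∈ uIcc s t, E r ∈ unitary 𝔄)
    (hc : ∀ r ∈ uIcc s t, ‖star (U r) * (H r - K r) * U r - G r‖ ≤ c) :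
    ‖U t - V t * star (E t)‖ ≤ c * |t - s| := by
  -- The product is `1` at `s` and would stay `1` if `G` were the exact interaction picture
  -- generator; its speed is the norm of the discrepancy, since all the other factors are unitary.
  have hD : ∀ r ∈ uIcc s t, HasDerivWithinAt (fun r => star (E r) * (star (U r) * V r))
      (star (E r) * (Complex.I • (star (U r) * (H r - K r) * U r - G r)) * (star (U r) * V r))
      (uIcc s t) r := by
    intro r hr
    refine ((hE r hr).star.mul ((hU r hr).star.mul (hV r hr))).congr_deriv ?_
    have hUU : U r * (star (U r) * V r) = V r := by
      rw [← mul_assoc, Unitary.mul_star_self_of_mem (hUu r hr), one_mul]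
    rw [star_mul, star_mul, star_smul, star_neg_I_smul (hH r hr), (hG r hr).star_eq]
    simp only [Pi.mul_apply, smul_mul_assoc, mul_smul_comm, mul_add, mul_sub, sub_mul,
      mul_assoc, mul_neg, neg_mul, neg_smul, smul_sub, neg_neg, hUU, RCLike.star_def,
      Complex.conj_I]
    module
  have ht : t ∈ uIcc s t := right_mem_uIcc
  have hmain := Convex.norm_image_sub_le_of_norm_hasDerivWithin_le hD (C := c) (fun r hr => by
    rw [CStarRing.norm_mul_mem_unitary _ (mul_mem (Unitary.star_mem (hUu r hr)) (hVu r hr)),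
      CStarRing.norm_mem_unitary_mul _ (Unitary.star_mem (hEu r hr)), norm_smul]
    simpa using hc r hr) (convex_uIcc s t) left_mem_uIcc ht
  have hEE : E t * star (E t) = 1 := Unitary.mul_star_self_of_mem (hEu t ht)
  have hUU : U t * star (U t) = 1 := Unitary.mul_star_self_of_mem (hUu t ht)
  have hfac : U t - V t * star (E t) =
      -(U t * E t * (star (E t) * (star (U t) * V t) - 1) * star (E t)) := by
    calc U t - V t * star (E t)
        = U t * (E t * star (E t)) -
          U t * (E t * star (E t)) * star (U t) * V t * star (E t) := by
          rw [hEE, mul_one, hUU, one_mul]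
      _ = _ := by noncomm_ring
  rw [hfac, norm_neg, CStarRing.norm_mul_mem_unitary _ (Unitary.star_mem (hEu t ht)),
    CStarRing.norm_mem_unitary_mul _ (mul_mem (hUu t ht) (hEu t ht))]
  simpa [hUs, hVs, hEs] using hmain

end Comparison

/-! ### Finite-volume evolutions and locality of the Heisenberg dynamics. -/

section Dynamics

variable {Γ : Type*} [DecidableEq Γ]
  {ι : Γ → Type*} [∀ x, Fintype (ι x)] [∀ x, DecidableEq (ι x)]
  {T : ℝ} {Ψ : ∀ Z : Finset Γ, ℝ → Obs ι Z}

theorem isSolution_solution (hT : 0 < T) {Λ : Finset Γ} (s : ℝ) {A : ℝ → Obs ι Λ}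
    (hA : ContinuousOn A (Icc (-T) T)) : IsSolution T s A (solution T s A) :=
  Classical.epsilon_spec (p := IsSolution T s A)
    (exists_hasDerivWithinAt_of_continuousOn (𝔄 := Obs ι Λ) (by linarith) hA s)

theorem IsSolution.mem_unitary {Λ : Finset Γ} {s : ℝ} (hs : s ∈ Icc (-T) T) {A U : ℝ → Obs ι Λ}
    (hU : IsSolution T s A U) (hA : ∀ t ∈ Icc (-T) T, star (A t) = -A t) {t : ℝ}
    (ht : t ∈ Icc (-T) T) : U t ∈ unitary (Obs ι Λ) :=
  mem_unitary_of_hasDerivWithinAt (𝔄 := Obs ι Λ) hs hA hU.1 hU.2 ht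

theorem isSelfAdjoint_ham (hΨself : ∀ Z, ∀ t ∈ Icc (-T) T, IsSelfAdjoint (Ψ Z t)) (Λ : Finset Γ)
    {t : ℝ} (ht : t ∈ Icc (-T) T) : IsSelfAdjoint (ham Ψ Λ t) :=
  _root_.isSelfAdjoint_sum _ fun Z _ => isSelfAdjoint_embed Λ (hΨself Z t ht)

theorem continuousOn_sum_embed (hΨcont : ∀ Z, ContinuousOn (Ψ Z) (Icc (-T) T))
    {Λ : Finset Γ} {P : Finset (Finset Γ)} (hP : ∀ Z ∈ P, Z ⊆ Λ) :
    ContinuousOn (fun t => ∑ Z ∈ P, embed Λ (Ψ Z t)) (Icc (-T) T) :=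
  continuousOn_finsetSum _ fun Z hZ => continuousOn_embed (hP Z hZ) (hΨcont Z)

theorem isSolution_evol (hT : 0 < T) (hΨcont : ∀ Z, ContinuousOn (Ψ Z) (Icc (-T) T))
    (Λ : Finset Γ) (s : ℝ) :
    IsSolution T s (fun r => -Complex.I • ham Ψ Λ r) (fun r => evol T Ψ Λ r s) :=
  isSolution_solution hT s (A := fun r => -Complex.I • ham Ψ Λ r)
    ((continuousOn_sum_embed (P := Λ.powerset) hΨcont
      fun _ hZ => Finset.mem_powerset.1 hZ).const_smul (-Complex.I))

theorem evol_mem_unitary (hT : 0 < T) (hΨself : ∀ Z, ∀ t ∈ Icc (-T) T, IsSelfAdjoint (Ψ Z t))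
    (hΨcont : ∀ Z, ContinuousOn (Ψ Z) (Icc (-T) T)) (Λ : Finset Γ) {s t : ℝ}
    (hs : s ∈ Icc (-T) T) (ht : t ∈ Icc (-T) T) : evol T Ψ Λ t s ∈ unitary (Obs ι Λ) :=
  (isSolution_evol hT hΨcont Λ s).mem_unitary hs
    (fun _ hr => star_neg_I_smul (isSelfAdjoint_ham hΨself Λ hr)) ht

/-- The evolution of a subregion, embedded into the algebra of a larger region. -/
theorem hasDerivWithinAt_embed_evol (hT : 0 < T)
    (hΨcont : ∀ Z, ContinuousOn (Ψ Z) (Icc (-T) T)) {Y Λ : Finset Γ} (hY : Y ⊆ Λ) (s : ℝ) {r : ℝ}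
    (hr : r ∈ Icc (-T) T) :
    HasDerivWithinAt (fun r => embed Λ (evol T Ψ Y r s))
      (-Complex.I • (∑ Z ∈ Y.powerset, embed Λ (Ψ Z r)) * embed Λ (evol T Ψ Y r s))
      (Icc (-T) T) r := by
  refine (hasDerivWithinAt_embed hY ((isSolution_evol hT hΨcont Y s).2 r hr)).congr_deriv ?_
  rw [embed_mul hY, embed_smul hY, ham, embed_sum hY, Finset.sum_congr rfl fun Z hZ =>
    embed_embed (Finset.mem_powerset.1 hZ) hY (Ψ Z r)]

theorem continuousOn_surfaceGen (hT : 0 < T) (hΨcont : ∀ Z, ContinuousOn (Ψ Z) (Icc (-T) T))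
    {Λ : Finset Γ} (s : ℝ) {S : ℝ → Obs ι Λ} (hS : ContinuousOn S (Icc (-T) T)) :
    ContinuousOn (fun r => Complex.I • heis T Ψ Λ r s (S r)) (Icc (-T) T) := by
  have hU : ContinuousOn (fun r => evol T Ψ Λ r s) (Icc (-T) T) := fun r hr =>
    ((isSolution_evol hT hΨcont Λ s).2 r hr).continuousWithinAt
  exact ContinuousOn.const_smul (M := ℂ) ((hU.star.mul hS).mul hU) Complex.I

theorem isSelfAdjoint_heis {Λ : Finset Γ} (r s : ℝ) {A : Obs ι Λ} (hA : IsSelfAdjoint A) :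
    IsSelfAdjoint (heis T Ψ Λ r s A) := by
  rw [isSelfAdjoint_iff, heis, star_mul, star_mul, star_star, hA.star_eq, mul_assoc]

theorem norm_le_supNorm (hΨcont : ∀ Z, ContinuousOn (Ψ Z) (Icc (-T) T)) (Z : Finset Γ) {r : ℝ}
    (hr : r ∈ Icc (-T) T) : ‖Ψ Z r‖ ≤ supNorm T Ψ Z := by
  obtain ⟨K, hK⟩ := isCompact_Icc.exists_bound_of_continuousOn (hΨcont Z)
  exact le_ciSup (f := fun t : Icc (-T) T => ‖Ψ Z t‖)
    ⟨K, by rintro _ ⟨x, rfl⟩; exact hK x x.2⟩ ⟨r, hr⟩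

theorem supNorm_nonneg (Z : Finset Γ) : 0 ≤ supNorm T Ψ Z :=
  Real.iSup_nonneg fun _ => norm_nonneg _

/-- Comparison of the Heisenberg dynamics of two regions on an observable of a common
subregion. -/
theorem norm_heis_sub_embed_heis_le (hT : 0 < T)
    (hΨself : ∀ Z, ∀ t ∈ Icc (-T) T, IsSelfAdjoint (Ψ Z t))
    (hΨcont : ∀ Z, ContinuousOn (Ψ Z) (Icc (-T) T))
    {f : Γ → Γ → ℝ} {ψ C : ℝ} (hf : ∀ x y, 0 ≤ f x y) (hfsymm : ∀ x y, f x y = f y x)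
    (hψ0 : 0 ≤ ψ) (hC : 0 < C) {Y Λ' Λ : Finset Γ}
    (hψ : ∀ x y, ∑ Z ∈ Λ.powerset with x ∈ Z ∧ y ∈ Z, supNorm T Ψ Z ≤ ψ * f x y)
    (hconv : ∀ x y, ∑ z ∈ Λ, f x z * f z y ≤ C * f x y)
    (hY : Y ⊆ Λ') (hΛ : Λ' ⊆ Λ) {s r : ℝ} (hs : s ∈ Icc (-T) T)
    (hr : r ∈ Icc (-T) T) (A : Obs ι Y) :
    ‖heis T Ψ Λ r s (embed Λ A) - embed Λ (heis T Ψ Λ' r s (embed Λ' A))‖ ≤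
      ‖A‖ * C⁻¹ * (Real.exp (2 * ψ * C * |r - s|) - 1) * ∑ y ∈ Y, ∑ w ∈ Λ \ Λ', f y w := by
  -- The sign `σ` is the direction of time. Reparametrising by elapsed time and putting `σ` into the
  -- interaction reduces evolution backwards from `s` to evolution forwards from `0`.
  obtain ⟨σ, hσ, hσr⟩ : ∃ σ : ℝ, |σ| = 1 ∧ s + σ * |r - s| = r := by
    rcases le_total s r with h | h
    · exact ⟨1, by simp, by rw [abs_of_nonneg (sub_nonneg.2 h)]; ring⟩
    · exact ⟨-1, by simp, by rw [abs_of_nonpos (sub_nonpos.2 h)]; ring⟩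
  set L := |r - s| with hL
  have hL0 : 0 ≤ L := abs_nonneg _
  have hmaps : MapsTo (fun q => s + σ * q) (Icc 0 L) (Icc (-T) T) := by
    intro q hq
    rcases eq_or_lt_of_le hL0 with h0 | h0
    · have : q = 0 := le_antisymm (h0 ▸ hq.2) hq.1
      simpa [this] using hs
    · have : s + σ * q = (1 - q / L) * s + (q / L) * r := by
        rw [← hσr]
        field_simp
        ring
      change s + σ * q ∈ _
      rw [this]
      exact convex_Icc (-T) T hs hr (sub_nonneg.2 (by rw [div_le_one h0]; exact hq.2))
        (div_nonneg hq.1 hL0) (by ring)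
  have htime : ∀ q, HasDerivWithinAt (fun q => s + σ * q) σ (Icc 0 L) q := fun q => by
    simpa using (((hasDerivAt_id q).const_mul σ).const_add s).hasDerivWithinAt
  let Φ : Finset Γ → ℝ → Obs ι Λ := fun Z q => σ • embed Λ (Ψ Z (s + σ * q))
  have hsub : ∀ {Z}, Z ∈ Λ.powerset → Z ⊆ Λ := fun hZ => Finset.mem_powerset.1 hZ
  -- Locality includes `Y ⊆ Λ`, because `embed` has the default value `0` otherwise and the
  -- commutation of disjoint supports is proved for subsets of `Λ`.
  have hloc : IsLocalFamily (𝔄 := Obs ι Λ)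
      (fun Y => {A | Y ⊆ Λ ∧ ∃ A₀ : Obs ι Y, A = embed Λ A₀}) Λ Λ.powerset Φ
      (supNorm T Ψ) f ψ C 0 L := by
    refine ⟨?_, fun Z => hsub, ?_, ?_, ?_, ?_, fun Z _ => supNorm_nonneg Z, hf, hfsymm, hψ0, hC,
      hψ, hconv⟩
    · rintro Y Z _ _ hYZ ⟨hY, A, rfl⟩ ⟨hZ, B, rfl⟩
      exact commute_embed hYZ hY hZ A B
    · intro Z hZ q _
      refine ⟨hsub hZ, (σ : ℂ) • Ψ Z (s + σ * q), ?_⟩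
      rw [embed_smul (hsub hZ)]
      rfl
    · intro Z _ q hq
      exact IsSelfAdjoint.smul (IsSelfAdjoint.all σ) (isSelfAdjoint_embed Λ (hΨself Z _ (hmaps hq)))
    · intro Z hZ
      exact ((continuousOn_embed (hsub hZ) (hΨcont Z)).comp
        (by fun_prop : Continuous fun q => s + σ * q).continuousOn hmaps).const_smul σ
    · intro Z hZ q hq
      rw [norm_smul, Real.norm_eq_abs, hσ, one_mul]
      exact (norm_embed_le (hsub hZ) _).trans (norm_le_supNorm hΨcont Z (hmaps hq))
  have hder : ∀ Y' : Finset Γ, Y' ⊆ Λ → ∀ q ∈ Icc 0 L,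
      HasDerivWithinAt (fun q => embed Λ (evol T Ψ Y' (s + σ * q) s))
        (-Complex.I • (∑ Z ∈ Y'.powerset, Φ Z q) * embed Λ (evol T Ψ Y' (s + σ * q) s))
        (Icc 0 L) q := by
    intro Y' hY' q hq
    refine HasDerivWithinAt.congr_deriv (HasDerivWithinAt.scomp
      (g₁ := fun r => embed Λ (evol T Ψ Y' r s)) (h := fun q => s + σ * q) q
      (hasDerivWithinAt_embed_evol hT hΨcont hY' s (hmaps hq)) (htime q) hmaps) ?_
    simp only [Φ, ← Finset.smul_sum]
    rw [smul_comm (-Complex.I) σ, smul_mul_assoc σ]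
  have hone : ∀ Y' : Finset Γ, Y' ⊆ Λ → embed Λ (evol T Ψ Y' (s + σ * 0) s) = 1 := by
    intro Y' hY'
    rw [mul_zero, add_zero, show evol T Ψ Y' s s = 1 from (isSolution_evol hT hΨcont Y' s).1,
      embed_one hY']
  have hfilter : Λ.powerset.filter (· ⊆ Λ') = Λ'.powerset := by
    ext Z
    simp only [Finset.mem_filter, Finset.mem_powerset]
    exact ⟨fun h => h.2, fun h => ⟨h.trans hΛ, h⟩⟩
  have hself : ∀ A : Obs ι Λ, embed Λ A = A := by
    intro A
    ext η η'
    rw [embed_apply subset_rfl, if_pos fun x hx => (hx x.2).elim]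
    rfl
  have hmain := hloc.norm_heisenberg_sub_le hL0 Λ' (hone Λ subset_rfl) (hone Λ' hΛ)
    (hder Λ subset_rfl) (by rw [hfilter]; exact hder Λ' hΛ) (Y := Y) (A := embed Λ A)
    ⟨hY.trans hΛ, A, rfl⟩
  simp only [hσr, hself, sub_zero] at hmain
  rw [heis, heis, embed_mul hΛ, embed_mul hΛ, embed_star hΛ, embed_embed hY hΛ]
  refine hmain.trans ?_
  have h1 : 0 ≤ Real.exp (2 * ψ * C * L) - 1 :=
    sub_nonneg.2 (Real.one_le_exp (by positivity))
  have h2 : 0 ≤ ∑ y ∈ Y, ∑ w ∈ Λ \ Λ', f y w :=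
    Finset.sum_nonneg fun _ _ => Finset.sum_nonneg fun _ _ => hf _ _
  gcongr
  exact norm_embed_le (hY.trans hΛ) A

end Dynamics

/-! ### Distances, layers and fattened boundaries. -/

section Distance

variable {Γ : Type*} {𝒢 : SimpleGraph Γ}

theorem setDist_le_iff {x : Γ} {S : Set Γ} {n : ℕ} :
    setDist 𝒢 x S ≤ n ↔ ∃ y ∈ S, 𝒢.dist x y ≤ n := by
  constructor
  · intro h
    by_contra! hc
    have : ((n + 1 : ℕ) : ℕ∞) ≤ setDist 𝒢 x S :=
      le_iInf₂ fun y hy => by exact_mod_cast hc y hy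
    have := this.trans h
    norm_cast at this
    omega
  · rintro ⟨y, hy, hn⟩
    exact (iInf₂_le y hy).trans (by exact_mod_cast hn)

theorem setDist_le_zero_iff (hconn : 𝒢.Connected) {x : Γ} {S : Set Γ} :
    setDist 𝒢 x S ≤ (0 : ℕ) ↔ x ∈ S := by
  rw [setDist_le_iff]
  constructor
  · rintro ⟨y, hy, h⟩
    rwa [hconn.dist_eq_zero_iff.1 (Nat.le_zero.1 h)]
  · exact fun h => ⟨x, h, by simp⟩

/-- Distances are integers, so the first inner layer is exactly `∂X`; monotonicity of the layers
then bounds every layer by `|∂X|`. -/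
theorem innerFat_one_diff_innerFat_zero (hconn : 𝒢.Connected) (X : Finset Γ) :
    innerFat 𝒢 X 1 \ innerFat 𝒢 X 0 = innerBoundary 𝒢 X := by
  ext x
  have h0 := setDist_le_zero_iff hconn (x := x) (S := (X : Set Γ)ᶜ)
  simp only [innerFat, innerBoundary, Set.mem_sdiff, mem_ofPred_eq, h0]
  simp only [mem_compl_iff, Finset.mem_coe, not_not]
  rw [and_comm]
  refine and_congr_right fun hx => ⟨fun h => le_antisymm (by simpa using h) ?_,
    fun h => by simp [h]⟩
  rw [Order.one_le_iff_ne_zero]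
  intro h'
  exact h0.1 (by simp [h']) hx

theorem ncard_layer_le (hconn : 𝒢.Connected) {X : Finset Γ}
    (hX : ∀ n m : ℕ, 1 ≤ n → n ≤ m →
      (innerFat 𝒢 X m \ innerFat 𝒢 X (m - 1)).ncard ≤
        (innerFat 𝒢 X n \ innerFat 𝒢 X (n - 1)).ncard) {n : ℕ} (hn : 1 ≤ n) :
    (innerFat 𝒢 X n \ innerFat 𝒢 X (n - 1)).ncard ≤ (innerBoundary 𝒢 X).ncard := by
  rw [← innerFat_one_diff_innerFat_zero hconn X]
  exact hX 1 n le_rfl hn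

/-- The distance to the complement of `X`, as a natural number. -/
noncomputable def depth (𝒢 : SimpleGraph Γ) (X : Finset Γ) (x : Γ) : ℕ :=
  (setDist 𝒢 x (X : Set Γ)ᶜ).toNat

theorem depth_le_iff {X : Finset Γ} {w : Γ} (hw : w ∉ X) {x : Γ} {n : ℕ} :
    depth 𝒢 X x ≤ n ↔ x ∈ innerFat 𝒢 X n := by
  have hfin : setDist 𝒢 x (X : Set Γ)ᶜ ≠ ⊤ := by
    have : setDist 𝒢 x (X : Set Γ)ᶜ ≤ (𝒢.dist x w : ℕ) := setDist_le_iff.2 ⟨w, by simpa, le_rfl⟩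
    exact (this.trans_lt (ENat.natCast_lt_top _)).ne
  rw [innerFat, mem_ofPred_eq, depth]
  conv_rhs => rw [← ENat.natCast_toNat hfin]
  exact Nat.cast_le.symm

theorem depth_le_dist {X : Finset Γ} {w : Γ} (hw : w ∉ X) (x : Γ) :
    depth 𝒢 X x ≤ 𝒢.dist x w :=
  (depth_le_iff hw).2 (setDist_le_iff.2 ⟨w, by simpa, le_rfl⟩)

theorem one_le_depth (hconn : 𝒢.Connected) {X : Finset Γ} {w : Γ} (hw : w ∉ X) {x : Γ}
    (hx : x ∈ X) : 1 ≤ depth 𝒢 X x := by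
  by_contra! h
  have := (depth_le_iff (𝒢 := 𝒢) hw).1 (Nat.lt_one_iff.1 h).le
  exact (setDist_le_zero_iff hconn).1 this hx

theorem card_depth_eq_le (hconn : 𝒢.Connected) {X : Finset Γ}
    (hX : ∀ n m : ℕ, 1 ≤ n → n ≤ m →
      (innerFat 𝒢 X m \ innerFat 𝒢 X (m - 1)).ncard ≤
        (innerFat 𝒢 X n \ innerFat 𝒢 X (n - 1)).ncard) {w : Γ} (hw : w ∉ X) (n : ℕ) :
    (X.filter fun x => depth 𝒢 X x = n).card ≤ (innerBoundary 𝒢 X).ncard := by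
  rcases Nat.eq_zero_or_pos n with rfl | hn
  · rw [Finset.card_eq_zero.2]
    · exact Nat.zero_le _
    · exact Finset.filter_eq_empty_iff.2 fun x hx h =>
        absurd (one_le_depth hconn hw hx) (by omega)
  · refine le_trans (le_of_eq ?_) (ncard_layer_le hconn hX hn)
    rw [← Set.ncard_coe_finset]
    congr 1
    ext x
    rw [Set.mem_sdiff, ← depth_le_iff hw, ← depth_le_iff hw]
    simp only [Finset.coe_filter, mem_ofPred_eq]
    constructor
    · rintro ⟨-, h⟩; omega
    · intro h
      refine ⟨?_, by omega⟩
      by_contra hx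
      have := (depth_le_iff (𝒢 := 𝒢) hw).2 ((setDist_le_zero_iff hconn).2
        (show x ∈ (X : Set Γ)ᶜ by simpa))
      omega

/-- A path from `X` to a vertex of distance greater than `h` to `X` first has to leave `X`. -/
theorem depth_add_le_dist (hconn : 𝒢.Connected) {X : Finset Γ} {x y : Γ} (hx : x ∈ X)
    {h : ℕ} (hy : ∀ u ∈ X, h < 𝒢.dist u y) : depth 𝒢 X x + h ≤ 𝒢.dist x y := by
  classical
  have hyX : y ∉ X := fun hyX => by simpa using hy y hyX
  obtain ⟨p, hp⟩ := hconn.exists_walk_length_eq_dist x y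
  obtain ⟨e, he, heX, heX'⟩ := p.exists_boundary_dart (X : Set Γ) hx hyX
  have hw : e.snd ∈ p.support := p.dart_snd_mem_support_of_mem_darts he
  have hlen : (p.takeUntil _ hw).length + (p.dropUntil _ hw).length = 𝒢.dist x y := by
    rw [← hp, ← SimpleGraph.Walk.length_append, p.take_spec hw]
  -- On a geodesic, the part up to the first vertex after an exit from `X` has length at least the
  -- depth of `x`. The rest has length at least `h`: the last vertex inside is farther than `h` from
  -- `y`, and the exit edge costs one step.
  have h1 : depth 𝒢 X x ≤ (p.takeUntil _ hw).length :=
    (depth_le_dist heX' x).trans (SimpleGraph.dist_le _)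
  have h2 : 𝒢.dist e.snd y ≤ (p.dropUntil _ hw).length := SimpleGraph.dist_le _
  have h3 : 𝒢.dist e.fst y ≤ 𝒢.dist e.fst e.snd + 𝒢.dist e.snd y := hconn.dist_triangle
  have h4 : 𝒢.dist e.fst e.snd = 1 := SimpleGraph.dist_eq_one_iff_adj.2 e.adj
  have h5 := hy e.fst heX
  omega

theorem lt_dist_add_of_setDist (hconn : 𝒢.Connected) {S : Set Γ} {y w : Γ} {h R : ℕ}
    (hy : setDist 𝒢 y S ≤ h) (hw : ¬setDist 𝒢 w S ≤ R) : R < 𝒢.dist y w + h := by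
  obtain ⟨x, hx, hyx⟩ := setDist_le_iff.1 hy
  rw [setDist_le_iff] at hw
  push Not at hw
  have h1 := hw x hx
  have h2 : 𝒢.dist w x ≤ 𝒢.dist w y + 𝒢.dist y x := hconn.dist_triangle
  rw [𝒢.dist_comm (u := w) (v := y)] at h2
  omega

/-- The finite set `Λ` containing the outer fattening makes `∂_R X` finite, which rules out the
default value `∅` in `fatBdry`. -/
theorem coe_fatBdry {X Λ : Finset Γ} {R : ℕ} (h : outerFat 𝒢 X R ⊆ (Λ : Set Γ)) :
    (fatBdry 𝒢 X R : Set Γ) = fatBoundary 𝒢 X R := by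
  have hfin : (fatBoundary 𝒢 X R).Finite :=
    (Λ.finite_toSet.subset h).subset inter_subset_left
  rw [fatBdry, dif_pos hfin, Set.Finite.coe_toFinset]

theorem outerFat_mono (X : Finset Γ) {h R : ℕ} (hR : h ≤ R) :
    outerFat 𝒢 X h ⊆ outerFat 𝒢 X R := fun _ hx =>
  le_trans (b := (h : ℕ∞)) hx (by exact_mod_cast hR)

theorem innerFat_mono (X : Finset Γ) {h R : ℕ} (hR : h ≤ R) :
    innerFat 𝒢 X h ⊆ innerFat 𝒢 X R := fun _ hx =>
  le_trans (b := (h : ℕ∞)) hx (by exact_mod_cast hR)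

/-- Group the points by the value of `k`: values start at `h + 1` and each is taken at most `b`
times, so the sum is dominated by `b` copies of the tail series. -/
theorem sum_layers_le {ξ : ℝ → ℝ} (hξ : ∀ n : ℕ, 0 ≤ ξ n) {h : ℕ}
    (hsum : Summable fun k : ℕ => ξ ((h + 1 + k : ℕ) : ℝ)) {X : Finset Γ} {k : Γ → ℕ} {b : ℕ}
    (hk : ∀ x ∈ X, h + 1 ≤ k x) (hb : ∀ n, (X.filter fun x => k x = n).card ≤ b) :
    ∑ x ∈ X, ξ (k x) ≤ b * tail ξ h := by
  classical
  obtain ⟨N, hN⟩ : ∃ N, ∀ x ∈ X, k x - (h + 1) ∈ Finset.range N := by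
    refine ⟨X.sup k + 1, fun x hx => ?_⟩
    have := Finset.le_sup (f := k) hx
    rw [Finset.mem_range]
    omega
  rw [← Finset.sum_fiberwise_of_maps_to hN, tail, ← tsum_mul_left]
  refine le_trans (Finset.sum_le_sum fun j _ => ?_)
    ((hsum.mul_left (b : ℝ)).sum_le_tsum (Finset.range N) fun j _ =>
      mul_nonneg (Nat.cast_nonneg b) (hξ _))
  have he : (X.filter fun x => k x - (h + 1) = j) = X.filter fun x => k x = h + 1 + j := by
    refine Finset.filter_congr fun x hx => ?_
    have := hk x hx
    omega
  rw [he, Finset.sum_congr rfl fun x hx => by rw [(Finset.mem_filter.1 hx).2], Finset.sum_const,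
    nsmul_eq_mul]
  exact mul_le_mul_of_nonneg_right (by exact_mod_cast hb _) (hξ _)

end Distance

/-! ### Constants of the decay functions and superpolynomial decay. -/

section Decay

variable {Γ : Type*} {𝒢 : SimpleGraph Γ}

theorem sum_le_intNorm {F : ℝ → ℝ} (hF : ∀ r, 0 ≤ r → 0 < F r)
    (hsum : ∀ x, Summable fun y => F (𝒢.dist x y))
    (hint : BddAbove (range fun x => ∑' y, F (𝒢.dist x y))) (x : Γ) (s : Finset Γ) :
    ∑ y ∈ s, F (𝒢.dist x y) ≤ intNorm 𝒢 F :=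
  ((hsum x).sum_le_tsum s fun _ _ => (hF _ (Nat.cast_nonneg _)).le).trans (le_ciSup hint x)

theorem intNorm_nonneg {F : ℝ → ℝ} (hF : ∀ r, 0 ≤ r → 0 < F r) : 0 ≤ intNorm 𝒢 F :=
  Real.iSup_nonneg fun _ => tsum_nonneg fun _ => (hF _ (Nat.cast_nonneg _)).le

theorem convConst_pos [Nonempty Γ] {F : ℝ → ℝ} (hF : ∀ r, 0 ≤ r → 0 < F r)
    (hsum : ∀ x z, Summable fun y => F (𝒢.dist x y) * F (𝒢.dist y z) / F (𝒢.dist x z))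
    (hconv : BddAbove (range fun p : Γ × Γ =>
      ∑' y, F (𝒢.dist p.1 y) * F (𝒢.dist y p.2) / F (𝒢.dist p.1 p.2))) :
    0 < convConst 𝒢 F := by
  have hp : ∀ x y : Γ, 0 < F (𝒢.dist x y) := fun _ _ => hF _ (Nat.cast_nonneg _)
  obtain ⟨x⟩ := ‹Nonempty Γ›
  refine lt_of_lt_of_le ?_ (le_ciSup hconv (x, x))
  exact (hsum x x).tsum_pos (fun y => (div_pos (mul_pos (hp _ _) (hp _ _)) (hp _ _)).le) x
    (div_pos (mul_pos (hp _ _) (hp _ _)) (hp _ _))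

theorem sum_conv_le {F : ℝ → ℝ} (hF : ∀ r, 0 ≤ r → 0 < F r)
    (hsum : ∀ x z, Summable fun y => F (𝒢.dist x y) * F (𝒢.dist y z) / F (𝒢.dist x z))
    (hconv : BddAbove (range fun p : Γ × Γ =>
      ∑' y, F (𝒢.dist p.1 y) * F (𝒢.dist y p.2) / F (𝒢.dist p.1 p.2))) (s : Finset Γ) (x y : Γ) :
    ∑ z ∈ s, F (𝒢.dist x z) * F (𝒢.dist z y) ≤ convConst 𝒢 F * F (𝒢.dist x y) := by
  have hp : ∀ x y : Γ, 0 < F (𝒢.dist x y) := fun _ _ => hF _ (Nat.cast_nonneg _)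
  rw [← div_le_iff₀ (hp x y), Finset.sum_div]
  exact ((hsum x y).sum_le_tsum s fun z _ =>
    (div_pos (mul_pos (hp _ _) (hp _ _)) (hp _ _)).le).trans (le_ciSup hconv (x, y))

variable {F ξ : ℝ → ℝ}

theorem weighted_le (hF : ∀ r, 0 ≤ r → 0 < F r) (hξanti : AntitoneOn ξ (Ici 0)) (x y : Γ) :
    F (𝒢.dist x y) * ξ (𝒢.dist x y) ≤ F (𝒢.dist x y) * ξ 0 :=
  mul_le_mul_of_nonneg_left (hξanti self_mem_Ici (mem_Ici.2 (Nat.cast_nonneg _))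
    (Nat.cast_nonneg _)) (hF _ (Nat.cast_nonneg _)).le

theorem summable_weighted (hF : ∀ r, 0 ≤ r → 0 < F r) (hξ : ∀ r, 0 ≤ r → 0 < ξ r)
    (hξanti : AntitoneOn ξ (Ici 0)) (hsum : ∀ x, Summable fun y => F (𝒢.dist x y)) (x : Γ) :
    Summable fun y => F (𝒢.dist x y) * ξ (𝒢.dist x y) :=
  Summable.of_nonneg_of_le
    (fun _ => (mul_pos (hF _ (Nat.cast_nonneg _)) (hξ _ (Nat.cast_nonneg _))).le)
    (fun y => weighted_le hF hξanti x y) ((hsum x).mul_right (ξ 0))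

theorem bddAbove_weighted (hF : ∀ r, 0 ≤ r → 0 < F r) (hξ : ∀ r, 0 ≤ r → 0 < ξ r)
    (hξanti : AntitoneOn ξ (Ici 0)) (hsum : ∀ x, Summable fun y => F (𝒢.dist x y))
    (hint : BddAbove (range fun x => ∑' y, F (𝒢.dist x y))) :
    BddAbove (range fun x => ∑' y, F (𝒢.dist x y) * ξ (𝒢.dist x y)) := by
  obtain ⟨K, hK⟩ := hint
  refine ⟨K * ξ 0, ?_⟩
  rintro _ ⟨x, rfl⟩
  calc ∑' y, F (𝒢.dist x y) * ξ (𝒢.dist x y) ≤ ∑' y, F (𝒢.dist x y) * ξ 0 :=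
        (summable_weighted hF hξ hξanti hsum x).tsum_le_tsum (fun y => weighted_le hF hξanti x y)
          ((hsum x).mul_right (ξ 0))
    _ = (∑' y, F (𝒢.dist x y)) * ξ 0 := tsum_mul_right
    _ ≤ K * ξ 0 := mul_le_mul_of_nonneg_right (hK ⟨x, rfl⟩) (hξ 0 le_rfl).le

/-- Supermultiplicativity, monotonicity and the triangle inequality give `ξ(d(x,y)) ξ(d(y,z)) ≤
ξ(d(x,z))`. The weight thus only decreases each convolution quotient, and finiteness of `C_ξ` is
inherited from `C_F`. -/
theorem conv_weighted_le (hconn : 𝒢.Connected) (hF : ∀ r, 0 ≤ r → 0 < F r)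
    (hξ : ∀ r, 0 ≤ r → 0 < ξ r) (hξanti : AntitoneOn ξ (Ici 0))
    (hξsuper : ∀ a b, 0 ≤ a → 0 ≤ b → ξ a * ξ b ≤ ξ (a + b)) (x y z : Γ) :
    F (𝒢.dist x y) * ξ (𝒢.dist x y) * (F (𝒢.dist y z) * ξ (𝒢.dist y z)) /
      (F (𝒢.dist x z) * ξ (𝒢.dist x z)) ≤
      F (𝒢.dist x y) * F (𝒢.dist y z) / F (𝒢.dist x z) := by
  have hp : ∀ x y : Γ, 0 < F (𝒢.dist x y) := fun _ _ => hF _ (Nat.cast_nonneg _)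
  have hq : ∀ x y : Γ, 0 < ξ (𝒢.dist x y) := fun _ _ => hξ _ (Nat.cast_nonneg _)
  have h1 : ξ (𝒢.dist x y) * ξ (𝒢.dist y z) ≤ ξ (𝒢.dist x z) :=
    (hξsuper _ _ (Nat.cast_nonneg _) (Nat.cast_nonneg _)).trans
      (hξanti (mem_Ici.2 (Nat.cast_nonneg _)) (mem_Ici.2 (by positivity))
        (by exact_mod_cast hconn.dist_triangle))
  rw [div_le_div_iff₀ (mul_pos (hp x z) (hq x z)) (hp x z)]
  calc F (𝒢.dist x y) * ξ (𝒢.dist x y) * (F (𝒢.dist y z) * ξ (𝒢.dist y z)) * F (𝒢.dist x z)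
      = F (𝒢.dist x y) * F (𝒢.dist y z) * F (𝒢.dist x z) *
        (ξ (𝒢.dist x y) * ξ (𝒢.dist y z)) := by ring
    _ ≤ F (𝒢.dist x y) * F (𝒢.dist y z) * F (𝒢.dist x z) * ξ (𝒢.dist x z) :=
        mul_le_mul_of_nonneg_left h1
          (mul_pos (mul_pos (hp _ _) (hp _ _)) (hp _ _)).le
    _ = _ := by ring

theorem summable_conv_weighted (hconn : 𝒢.Connected) (hF : ∀ r, 0 ≤ r → 0 < F r)
    (hξ : ∀ r, 0 ≤ r → 0 < ξ r) (hξanti : AntitoneOn ξ (Ici 0))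
    (hξsuper : ∀ a b, 0 ≤ a → 0 ≤ b → ξ a * ξ b ≤ ξ (a + b))
    (hsum : ∀ x z, Summable fun y => F (𝒢.dist x y) * F (𝒢.dist y z) / F (𝒢.dist x z)) (x z : Γ) :
    Summable fun y => F (𝒢.dist x y) * ξ (𝒢.dist x y) * (F (𝒢.dist y z) * ξ (𝒢.dist y z)) /
      (F (𝒢.dist x z) * ξ (𝒢.dist x z)) := by
  have hp : ∀ x y : Γ, 0 < F (𝒢.dist x y) * ξ (𝒢.dist x y) := fun _ _ =>
    mul_pos (hF _ (Nat.cast_nonneg _)) (hξ _ (Nat.cast_nonneg _))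
  exact Summable.of_nonneg_of_le (fun y => (div_pos (mul_pos (hp _ _) (hp _ _)) (hp _ _)).le)
    (fun y => conv_weighted_le hconn hF hξ hξanti hξsuper x y z) (hsum x z)

theorem bddAbove_conv_weighted (hconn : 𝒢.Connected) (hF : ∀ r, 0 ≤ r → 0 < F r)
    (hξ : ∀ r, 0 ≤ r → 0 < ξ r) (hξanti : AntitoneOn ξ (Ici 0))
    (hξsuper : ∀ a b, 0 ≤ a → 0 ≤ b → ξ a * ξ b ≤ ξ (a + b))
    (hsum : ∀ x z, Summable fun y => F (𝒢.dist x y) * F (𝒢.dist y z) / F (𝒢.dist x z))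
    (hconv : BddAbove (range fun p : Γ × Γ =>
      ∑' y, F (𝒢.dist p.1 y) * F (𝒢.dist y p.2) / F (𝒢.dist p.1 p.2))) :
    BddAbove (range fun p : Γ × Γ => ∑' y, F (𝒢.dist p.1 y) * ξ (𝒢.dist p.1 y) *
      (F (𝒢.dist y p.2) * ξ (𝒢.dist y p.2)) / (F (𝒢.dist p.1 p.2) * ξ (𝒢.dist p.1 p.2))) := by
  obtain ⟨K, hK⟩ := hconv
  refine ⟨K, ?_⟩
  rintro _ ⟨p, rfl⟩
  exact ((summable_conv_weighted hconn hF hξ hξanti hξsuper hsum p.1 p.2).tsum_le_tsum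
    (fun y => conv_weighted_le hconn hF hξ hξanti hξsuper p.1 y p.2) (hsum p.1 p.2)).trans
      (hK ⟨p, rfl⟩)

/-- A superpolynomially decaying function is summable against powers along the integers. -/
theorem summable_mul_pow (hξ : ∀ r, 0 ≤ r → 0 < ξ r)
    (hξdecay : ∀ n : ℕ, Tendsto (fun r : ℝ => ξ r * r ^ n) atTop (𝓝 0)) (n : ℕ) :
    Summable fun k : ℕ => ξ k * (k : ℝ) ^ n := by
  refine summable_of_isBigO_nat (Real.summable_one_div_nat_pow.2 one_lt_two) ?_
  refine Asymptotics.IsBigO.of_bound 1 ?_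
  have h := ((hξdecay (n + 2)).comp tendsto_natCast_atTop_atTop).eventually
    (ge_mem_nhds (zero_lt_one : (0 : ℝ) < 1))
  filter_upwards [h, eventually_gt_atTop 0] with k hk hk0
  have hk0' : (0 : ℝ) < k := by exact_mod_cast hk0
  have hp := hξ k hk0'.le
  simp only [Function.comp_apply] at hk
  rw [Real.norm_of_nonneg (by positivity), Real.norm_of_nonneg (by positivity), one_mul,
    le_div_iff₀ (by positivity)]
  calc ξ k * (k : ℝ) ^ n * (k : ℝ) ^ 2 = ξ k * (k : ℝ) ^ (n + 2) := by ring
    _ ≤ 1 := hk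

theorem summable_tail (hξ : ∀ r, 0 ≤ r → 0 < ξ r)
    (hξdecay : ∀ n : ℕ, Tendsto (fun r : ℝ => ξ r * r ^ n) atTop (𝓝 0)) (h : ℕ) :
    Summable fun k : ℕ => ξ ((h + 1 + k : ℕ) : ℝ) := by
  have := (summable_nat_add_iff (f := fun k : ℕ => ξ k * (k : ℝ) ^ 0) (h + 1)).2
    (summable_mul_pow hξ hξdecay 0)
  simpa [add_comm, add_left_comm] using this

theorem tendsto_half : Tendsto (fun R : ℕ => R / 2) atTop atTop :=
  tendsto_atTop.2 fun b => by
    filter_upwards [eventually_ge_atTop (2 * b)] with R hR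
    omega

/-- Every index in the tail is at least `h + 1`, so the power can be moved inside as `k ^ n`; what
results is the tail of a convergent series. -/
theorem tendsto_tail_mul_pow (hξ : ∀ r, 0 ≤ r → 0 < ξ r)
    (hξdecay : ∀ n : ℕ, Tendsto (fun r : ℝ => ξ r * r ^ n) atTop (𝓝 0)) (n : ℕ) :
    Tendsto (fun h : ℕ => tail ξ h * ((h : ℝ) + 1) ^ n) atTop (𝓝 0) := by
  have hs := summable_mul_pow hξ hξdecay n
  have h0 : Tendsto (fun h : ℕ => ∑' k : ℕ, ξ ((k + (h + 1) : ℕ) : ℝ) *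
      (((k + (h + 1) : ℕ) : ℝ)) ^ n) atTop (𝓝 0) :=
    (tendsto_sum_nat_add fun k : ℕ => ξ k * (k : ℝ) ^ n).comp (tendsto_add_atTop_nat 1)
  refine squeeze_zero (fun h => ?_) (fun h => ?_) h0
  · exact mul_nonneg (tsum_nonneg fun k => (hξ _ (Nat.cast_nonneg _)).le) (by positivity)
  · rw [tail, ← tsum_mul_right]
    refine Summable.tsum_le_tsum (fun k => ?_) ((summable_tail hξ hξdecay h).mul_right _)
      ((summable_nat_add_iff (f := fun k : ℕ => ξ k * (k : ℝ) ^ n) (h + 1)).2 hs)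
    rw [add_comm (h + 1) k]
    have := hξ ((k + (h + 1) : ℕ) : ℝ) (Nat.cast_nonneg _)
    gcongr
    push_cast
    linarith [(Nat.cast_nonneg k : (0 : ℝ) ≤ k)]

theorem tendsto_mul_add_one_pow (hξ : ∀ r, 0 ≤ r → 0 < ξ r)
    (hξdecay : ∀ n : ℕ, Tendsto (fun r : ℝ => ξ r * r ^ n) atTop (𝓝 0)) (n : ℕ) :
    Tendsto (fun h : ℕ => ξ h * ((h : ℝ) + 1) ^ n) atTop (𝓝 0) := by
  have h0 := (((hξdecay n).comp tendsto_natCast_atTop_atTop).const_mul ((2 : ℝ) ^ n))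
  rw [mul_zero] at h0
  refine squeeze_zero' (Eventually.of_forall fun h => ?_) ?_ h0
  · exact mul_nonneg (hξ _ (Nat.cast_nonneg _)).le (by positivity)
  · filter_upwards [eventually_ge_atTop 1] with h hh
    have hh' : (1 : ℝ) ≤ h := by exact_mod_cast hh
    have := hξ h (Nat.cast_nonneg _)
    calc ξ h * ((h : ℝ) + 1) ^ n ≤ ξ h * (2 * (h : ℝ)) ^ n := by gcongr; linarith
      _ = _ := by rw [mul_pow]; simp only [Function.comp_apply]; ring

end Decay

/-! ### Strength of the surface terms and decay of the error bound. -/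

section SurfaceTerms

variable {Γ : Type*} [DecidableEq Γ] {𝒢 : SimpleGraph Γ} {F ξ : ℝ → ℝ}

theorem tail_nonneg (hξ : ∀ r, 0 ≤ r → 0 < ξ r) (h : ℕ) : 0 ≤ tail ξ h :=
  tsum_nonneg fun _ => (hξ _ (Nat.cast_nonneg _)).le

/-- The total strength of the terms which cross the surface of `X` and are not supported near it. -/
theorem sum_crossing_far_le (hconn : 𝒢.Connected) (hF : ∀ r, 0 ≤ r → 0 < F r)
    (hFsum : ∀ x, Summable fun y => F (𝒢.dist x y))
    (hFint : BddAbove (range fun x => ∑' y, F (𝒢.dist x y)))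
    (hξ : ∀ r, 0 ≤ r → 0 < ξ r) (hξanti : AntitoneOn ξ (Ici 0))
    (hξdecay : ∀ n : ℕ, Tendsto (fun r : ℝ => ξ r * r ^ n) atTop (𝓝 0))
    {X Λ : Finset Γ} (hX : ∀ n m : ℕ, 1 ≤ n → n ≤ m →
      (innerFat 𝒢 X m \ innerFat 𝒢 X (m - 1)).ncard ≤
        (innerFat 𝒢 X n \ innerFat 𝒢 X (n - 1)).ncard)
    {φ : Finset Γ → ℝ} {ψ : ℝ} (hψ0 : 0 ≤ ψ) (hφ : ∀ Z, 0 ≤ φ Z)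
    (hψ : ∀ x y, ∑ Z ∈ Λ.powerset with x ∈ Z ∧ y ∈ Z, φ Z ≤
      ψ * (F (𝒢.dist x y) * ξ (𝒢.dist x y)))
    (h : ℕ) {P : Finset (Finset Γ)} (hP : P ⊆ Λ.powerset)
    (hPX : ∀ Z ∈ P, (Z ∩ X).Nonempty ∧ (Z \ X).Nonempty ∧ ¬(Z : Set Γ) ⊆ fatBoundary 𝒢 X h) :
    ∑ Z ∈ P, φ Z ≤
      (innerBoundary 𝒢 X).ncard * ψ * intNorm 𝒢 F * (2 * tail ξ h) := by
  classical
  -- A member of `P` supplies a vertex outside `X`; without one the distance to the complement is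
  -- `⊤` and `depth` would be the default value `0`.
  rcases P.eq_empty_or_nonempty with rfl | ⟨Z₀, hZ₀⟩
  · rw [Finset.sum_empty]
    have h1 := tail_nonneg hξ h
    have h2 := intNorm_nonneg (𝒢 := 𝒢) hF
    positivity
  obtain ⟨w, hw⟩ := (hPX Z₀ hZ₀).2.1
  have hwX : w ∉ X := (Finset.mem_sdiff.1 hw).2
  -- A crossing term that leaves `∂_h X` either contains a deep point of `X`, in `X₁`, or a remote
  -- point outside, in `W₂`. These two alternatives give the factor 2 in front of the tail.
  let X₁ := X.filter fun x => h < depth 𝒢 X x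
  let W₂ := (Λ \ X).filter fun y => ∀ u ∈ X, h < 𝒢.dist u y
  have hψP : ∀ x y, ∑ Z ∈ P with x ∈ Z ∧ y ∈ Z, φ Z ≤
      ψ * (F (𝒢.dist x y) * ξ (𝒢.dist x y)) := fun x y =>
    (Finset.sum_le_sum_of_subset_of_nonneg (Finset.filter_subset_filter _ hP)
      fun Z _ _ => hφ Z).trans (hψ x y)
  have hite : ∀ Y W : Finset Γ, ∑ Z ∈ P, (if ¬Disjoint Y Z ∧ ¬Disjoint Z W then φ Z else 0) ≤
      ψ * ∑ y ∈ Y, ∑ v ∈ W, F (𝒢.dist y v) * ξ (𝒢.dist y v) := by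
    intro Y W
    refine le_trans (le_of_eq ?_) (sum_meet_both_le (fun Z _ => hφ Z) hψP Y W)
    rw [Finset.sum_filter]
    refine Finset.sum_congr rfl fun Z _ => ?_
    by_cases h1 : Disjoint Y Z <;> by_cases h2 : Disjoint Z W <;> simp [h1, h2]
  have hlayer : ∀ (Y W : Finset Γ) (k : Γ → ℕ), (∀ x ∈ Y, h + 1 ≤ k x) →
      (∀ n, (Y.filter fun x => k x = n).card ≤ (innerBoundary 𝒢 X).ncard) →
      (∀ x ∈ Y, ∀ y ∈ W, k x ≤ 𝒢.dist x y) →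
      ∑ x ∈ Y, ∑ y ∈ W, F (𝒢.dist x y) * ξ (𝒢.dist x y) ≤
        (innerBoundary 𝒢 X).ncard * tail ξ h * intNorm 𝒢 F := by
    intro Y W k hk hb hkW
    calc ∑ x ∈ Y, ∑ y ∈ W, F (𝒢.dist x y) * ξ (𝒢.dist x y)
        ≤ ∑ x ∈ Y, ∑ y ∈ W, F (𝒢.dist x y) * ξ (k x) :=
          Finset.sum_le_sum fun x hx => Finset.sum_le_sum fun y hy =>
            mul_le_mul_of_nonneg_left (hξanti (mem_Ici.2 (Nat.cast_nonneg _))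
              (mem_Ici.2 (Nat.cast_nonneg _)) (by exact_mod_cast hkW x hx y hy))
              (hF _ (Nat.cast_nonneg _)).le
      _ ≤ ∑ x ∈ Y, intNorm 𝒢 F * ξ (k x) := by
          refine Finset.sum_le_sum fun x _ => ?_
          rw [← Finset.sum_mul]
          exact mul_le_mul_of_nonneg_right (sum_le_intNorm hF hFsum hFint x W)
            (hξ _ (Nat.cast_nonneg _)).le
      _ = (∑ x ∈ Y, ξ (k x)) * intNorm 𝒢 F := by rw [← Finset.mul_sum, mul_comm]
      _ ≤ _ := mul_le_mul_of_nonneg_right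
          (sum_layers_le (fun n => (hξ n (Nat.cast_nonneg _)).le) (summable_tail hξ hξdecay h)
            hk hb) (intNorm_nonneg hF)
  have h1 := hlayer X₁ (Λ \ X) (depth 𝒢 X) (fun x hx => (Finset.mem_filter.1 hx).2)
    (fun n => (Finset.card_le_card (Finset.filter_subset_filter _ (Finset.filter_subset _ _))).trans
      (card_depth_eq_le hconn hX hwX n))
    (fun x _ y hy => depth_le_dist (Finset.mem_sdiff.1 hy).2 x)
  -- Points of `X` have depth at least 1, so the shifted depth starts at `h + 1`, as the tail
  -- requires.
  have h2 := hlayer X W₂ (fun x => depth 𝒢 X x + h)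
    (fun x hx => by have := one_le_depth hconn hwX hx; omega)
    (fun n => by
      refine le_trans (Finset.card_le_card ?_) (card_depth_eq_le hconn hX hwX (n - h))
      intro x hx
      obtain ⟨hx, hn⟩ := Finset.mem_filter.1 hx
      exact Finset.mem_filter.2 ⟨hx, by omega⟩)
    (fun x hx y hy => depth_add_le_dist hconn hx (Finset.mem_filter.1 hy).2)
  calc ∑ Z ∈ P, φ Z
      ≤ ∑ Z ∈ P, ((if ¬Disjoint X₁ Z ∧ ¬Disjoint Z (Λ \ X) then φ Z else 0) +
          (if ¬Disjoint X Z ∧ ¬Disjoint Z W₂ then φ Z else 0)) := by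
        refine Finset.sum_le_sum fun Z hZ => ?_
        obtain ⟨⟨x, hx⟩, ⟨y, hy⟩, hZfat⟩ := hPX Z hZ
        obtain ⟨hxZ, hxX⟩ := Finset.mem_inter.1 hx
        obtain ⟨hyZ, hyX⟩ := Finset.mem_sdiff.1 hy
        have hZΛ := Finset.mem_powerset.1 (hP hZ)
        have hnn : ∀ p : Prop, [Decidable p] → 0 ≤ if p then φ Z else 0 := fun _ _ => by
          split_ifs
          · exact hφ Z
          · exact le_rfl
        obtain ⟨z, hz, hzfat⟩ := Set.not_subset.1 hZfat
        by_cases hzX : z ∈ X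
        · have hz1 : h < depth 𝒢 X z := by
            by_contra! hle
            refine hzfat ⟨?_, (depth_le_iff hwX).1 hle⟩
            exact ((setDist_le_zero_iff hconn).2 (by exact_mod_cast hzX)).trans (by simp)
          rw [if_pos (c := ¬Disjoint X₁ Z ∧ _) ⟨Finset.not_disjoint_iff.2
            ⟨z, Finset.mem_filter.2 ⟨hzX, hz1⟩, hz⟩, Finset.not_disjoint_iff.2
            ⟨y, hyZ, Finset.mem_sdiff.2 ⟨hZΛ hyZ, hyX⟩⟩⟩]
          exact le_add_of_nonneg_right (hnn _)
        · have hz2 : ∀ u ∈ X, h < 𝒢.dist u z := by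
            intro u hu
            by_contra! hle
            refine hzfat ⟨setDist_le_iff.2 ⟨u, hu, by rwa [𝒢.dist_comm]⟩, ?_⟩
            exact ((setDist_le_zero_iff hconn).2 (by simpa using hzX)).trans (by simp)
          rw [if_pos (c := ¬Disjoint X Z ∧ _) ⟨Finset.not_disjoint_iff.2 ⟨x, hxX, hxZ⟩,
            Finset.not_disjoint_iff.2 ⟨z, hz, Finset.mem_filter.2
              ⟨Finset.mem_sdiff.2 ⟨hZΛ hz, hzX⟩, hz2⟩⟩⟩]
          exact le_add_of_nonneg_left (hnn _)
    _ ≤ ψ * ((innerBoundary 𝒢 X).ncard * tail ξ h * intNorm 𝒢 F) +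
        ψ * ((innerBoundary 𝒢 X).ncard * tail ξ h * intNorm 𝒢 F) := by
        rw [Finset.sum_add_distrib]
        exact add_le_add ((hite _ _).trans (mul_le_mul_of_nonneg_left h1 hψ0))
          ((hite _ _).trans (mul_le_mul_of_nonneg_left h2 hψ0))
    _ = _ := by ring

variable {ι : Γ → Type*} [∀ x, Fintype (ι x)] [∀ x, DecidableEq (ι x)]
  {T : ℝ} {Ψ : ∀ Z : Finset Γ, ℝ → Obs ι Z}

theorem sum_supNorm_le_intrNorm (hF : ∀ r, 0 ≤ r → 0 < F r)
    (hΨsum : ∀ x y, Summable fun Z : {Z : Finset Γ // x ∈ Z ∧ y ∈ Z} => supNorm T Ψ Z)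
    (hΨbdd : BddAbove (range fun p : Γ × Γ => pairStrength 𝒢 F T Ψ p.1 p.2))
    (P : Finset (Finset Γ)) (x y : Γ) :
    ∑ Z ∈ P with x ∈ Z ∧ y ∈ Z, supNorm T Ψ Z ≤ intrNorm 𝒢 F T Ψ * F (𝒢.dist x y) := by
  have hp : 0 < F (𝒢.dist x y) := hF _ (Nat.cast_nonneg _)
  have h1 : ∑ Z ∈ P with x ∈ Z ∧ y ∈ Z, supNorm T Ψ Z ≤
      ∑' Z : {Z : Finset Γ // x ∈ Z ∧ y ∈ Z}, supNorm T Ψ Z := by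
    rw [← Finset.sum_subtype_of_mem (p := fun Z : Finset Γ => x ∈ Z ∧ y ∈ Z) _
      fun Z hZ => (Finset.mem_filter.1 hZ).2]
    exact (hΨsum x y).sum_le_tsum _ fun Z _ => supNorm_nonneg _
  have h2 : pairStrength 𝒢 F T Ψ x y ≤ intrNorm 𝒢 F T Ψ := le_ciSup hΨbdd (x, y)
  rw [pairStrength, one_div, inv_mul_le_iff₀ hp] at h2
  exact h1.trans (h2.trans (le_of_eq (mul_comm _ _)))

theorem intrNorm_nonneg (hF : ∀ r, 0 ≤ r → 0 < F r) : 0 ≤ intrNorm 𝒢 F T Ψ :=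
  Real.iSup_nonneg fun _ => mul_nonneg (one_div_nonneg.2 (hF _ (Nat.cast_nonneg _)).le)
    (tsum_nonneg fun _ => supNorm_nonneg _)

theorem tendsto_errorBound_mul_pow (hξ : ∀ r, 0 ≤ r → 0 < ξ r)
    (hξdecay : ∀ n : ℕ, Tendsto (fun r : ℝ => ξ r * r ^ n) atTop (𝓝 0)) (G : ℝ) {d : ℝ}
    (hd : 0 ≤ d) (X : Finset Γ) (t s : ℝ) (n : ℕ) :
    Tendsto (fun R : ℕ => errorBound 𝒢 F ξ G d T Ψ X R t s * (R : ℝ) ^ n) atTop (𝓝 0) := by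
  obtain ⟨m, hm⟩ := exists_nat_ge (2 * d)
  have hRpow : ∀ R : ℕ, (R : ℝ) ^ n ≤ 2 ^ n * ((R / 2 : ℕ) + 1 : ℝ) ^ n := by
    intro R
    rw [← mul_pow]
    gcongr
    have : R ≤ 2 * (R / 2 + 1) := by omega
    exact_mod_cast this
  have h1 : Tendsto (fun R : ℕ => tail ξ (R / 2) * (R : ℝ) ^ n) atTop (𝓝 0) := by
    have h0 := (((tendsto_tail_mul_pow hξ hξdecay n).comp tendsto_half).const_mul ((2 : ℝ) ^ n))
    rw [mul_zero] at h0
    refine squeeze_zero (fun R => mul_nonneg (tail_nonneg hξ _) (by positivity)) (fun R => ?_) h0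
    calc tail ξ (R / 2) * (R : ℝ) ^ n ≤ tail ξ (R / 2) * (2 ^ n * ((R / 2 : ℕ) + 1 : ℝ) ^ n) :=
          mul_le_mul_of_nonneg_left (hRpow R) (tail_nonneg hξ _)
      _ = _ := by simp only [Function.comp_apply]; ring
  have h2 : Tendsto (fun R : ℕ => ((R / 2 : ℕ) : ℝ) ^ (2 * d) * ξ (R / 2 : ℕ) * (R : ℝ) ^ n)
      atTop (𝓝 0) := by
    have h0 := (((tendsto_mul_add_one_pow hξ hξdecay (m + n)).comp tendsto_half).const_mul
      ((2 : ℝ) ^ n))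
    rw [mul_zero] at h0
    refine squeeze_zero (fun R => ?_) (fun R => ?_) h0
    · have := hξ (R / 2 : ℕ) (Nat.cast_nonneg _)
      positivity
    · have hp := hξ (R / 2 : ℕ) (Nat.cast_nonneg _)
      have h3 : ((R / 2 : ℕ) : ℝ) ^ (2 * d) ≤ ((R / 2 : ℕ) + 1 : ℝ) ^ m := by
        calc ((R / 2 : ℕ) : ℝ) ^ (2 * d) ≤ ((R / 2 : ℕ) + 1 : ℝ) ^ (2 * d) :=
              Real.rpow_le_rpow (Nat.cast_nonneg _) (by linarith) (by linarith)
          _ ≤ ((R / 2 : ℕ) + 1 : ℝ) ^ (m : ℝ) :=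
              Real.rpow_le_rpow_of_exponent_le (by linarith [(Nat.cast_nonneg (R / 2) :
                (0 : ℝ) ≤ (R / 2 : ℕ))]) hm
          _ = _ := Real.rpow_natCast _ _
      calc ((R / 2 : ℕ) : ℝ) ^ (2 * d) * ξ (R / 2 : ℕ) * (R : ℝ) ^ n
          ≤ ((R / 2 : ℕ) + 1 : ℝ) ^ m * ξ (R / 2 : ℕ) * (2 ^ n * ((R / 2 : ℕ) + 1 : ℝ) ^ n) := by
            gcongr
            exact hRpow R
        _ = _ := by simp only [Function.comp_apply]; ring
  simp only [errorBound]
  generalize ((innerBoundary 𝒢 X).ncard : ℝ) = b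
  generalize Real.exp _ - 1 = e
  generalize G ^ 2 * _ / _ = κ
  generalize b * _ * _ * |t - s| = a
  have h3 := (h1.const_mul (a * 2)).add (h2.const_mul (a * (b * κ * e)))
  simp only [mul_zero, add_zero] at h3
  refine h3.congr fun R => ?_
  ring

/-- Strength of the surface energy. -/
theorem norm_sum_crossing_le {f : Γ → Γ → ℝ} {ψ N : ℝ} (hψ0 : 0 ≤ ψ) {Λ Y : Finset Γ}
    (hΨcont : ∀ Z, ContinuousOn (Ψ Z) (Icc (-T) T))
    (hψ : ∀ x y, ∑ Z ∈ Λ.powerset with x ∈ Z ∧ y ∈ Z, supNorm T Ψ Z ≤ ψ * f x y)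
    (hN : ∀ x, ∑ y ∈ Λ, f x y ≤ N) (hYΛ : Y ⊆ Λ) {P : Finset (Finset Γ)} (hP : P ⊆ Y.powerset)
    (hne : ∀ Z ∈ P, Z.Nonempty) {r : ℝ} (hr : r ∈ Icc (-T) T) :
    ‖∑ Z ∈ P, embed Y (Ψ Z r)‖ ≤ ψ * (Y.card * N) := by
  have hPY : ∀ Z ∈ P, Z ⊆ Y := fun Z hZ => Finset.mem_powerset.1 (hP hZ)
  calc ‖∑ Z ∈ P, embed Y (Ψ Z r)‖ ≤ ∑ Z ∈ P, supNorm T Ψ Z :=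
        norm_sum_le_of_le _ fun Z hZ =>
          (norm_embed_le (hPY Z hZ) _).trans (norm_le_supNorm hΨcont Z hr)
    -- The indicator equals 1 for nonempty subsets of `Λ`; inserting it allows the two-set estimate
    -- with second set `Λ`, whose inner sum is bounded by `N`.
    _ = ∑ Z ∈ P, supNorm T Ψ Z * (if Disjoint Z Λ then 0 else 1) := by
        refine Finset.sum_congr rfl fun Z hZ => ?_
        obtain ⟨z, hz⟩ := hne Z hZ
        rw [if_neg (Finset.not_disjoint_iff.2 ⟨z, hz, hYΛ (hPY Z hZ hz)⟩), mul_one]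
    _ ≤ ∑ Z ∈ Λ.powerset with ¬Disjoint Y Z,
          supNorm T Ψ Z * (if Disjoint Z Λ then 0 else 1) := by
        refine Finset.sum_le_sum_of_subset_of_nonneg (fun Z hZ => ?_) fun Z _ _ =>
          mul_nonneg (supNorm_nonneg Z) (by split_ifs <;> simp)
        obtain ⟨z, hz⟩ := hne Z hZ
        exact Finset.mem_filter.2 ⟨Finset.mem_powerset.2 ((hPY Z hZ).trans hYΛ),
          Finset.not_disjoint_iff.2 ⟨z, hPY Z hZ hz, hz⟩⟩
    _ ≤ ψ * ∑ y ∈ Y, ∑ w ∈ Λ, f y w := sum_meet_both_le (fun Z _ => supNorm_nonneg Z) hψ Y Λ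
    _ ≤ ψ * ∑ _y ∈ Y, N := by gcongr with y _; exact hN y
    _ = _ := by rw [Finset.sum_const, nsmul_eq_mul]

end SurfaceTerms

/-! ### Splitting the Hamiltonian along the surface of `X`. -/

section Factorisation

variable {Γ : Type*} [DecidableEq Γ]

theorem sum_powerset_eq_add {M : Type*} [AddCommMonoid M] {X Λ : Finset Γ} (hX : X ⊆ Λ)
    {g : Finset Γ → M} (hg : g ∅ = 0) :
    ∑ Z ∈ Λ.powerset, g Z = ∑ Z ∈ X.powerset, g Z + ∑ Z ∈ (Λ \ X).powerset, g Z +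
      ∑ Z ∈ Λ.powerset with (Z ∩ X).Nonempty ∧ (Z \ X).Nonempty, g Z := by
  have h1 : X.powerset = Λ.powerset.filter (· ⊆ X) := by
    ext Z
    simp only [Finset.mem_filter, Finset.mem_powerset]
    exact ⟨fun h => ⟨h.trans hX, h⟩, fun h => h.2⟩
  have h2 : (Λ \ X).powerset = Λ.powerset.filter (Disjoint · X) := by
    ext Z
    simp only [Finset.mem_filter, Finset.mem_powerset, Finset.subset_sdiff]
  rw [h1, h2, Finset.sum_filter, Finset.sum_filter, Finset.sum_filter, ← Finset.sum_add_distrib,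
    ← Finset.sum_add_distrib]
  refine Finset.sum_congr rfl fun Z _ => ?_
  simp only [Finset.sdiff_nonempty, ← Finset.not_disjoint_iff_nonempty_inter]
  by_cases h3 : Z ⊆ X <;> by_cases h4 : Disjoint Z X
  -- The empty set lies in both power sets and is counted twice, hence the assumption `g ∅ = 0`.
  · have : Z = ∅ := Finset.disjoint_self_iff_empty Z |>.1 (h4.mono_right h3)
    simp [this, hg]
  all_goals simp [h3, h4]

variable {ι : Γ → Type*} [∀ x, Fintype (ι x)] [∀ x, DecidableEq (ι x)]
  {T : ℝ} {Ψ : ∀ Z : Finset Γ, ℝ → Obs ι Z}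

/-- The product of the evolutions of `X` and of `Λ \ X` is generated by the terms which do not
cross the surface of `X`. -/
theorem hasDerivWithinAt_embed_evol_mul_embed_evol (hT : 0 < T)
    (hΨcont : ∀ Z, ContinuousOn (Ψ Z) (Icc (-T) T)) {X Λ : Finset Γ} (hX : X ⊆ Λ) (s : ℝ) {r : ℝ}
    (hr : r ∈ Icc (-T) T) :
    HasDerivWithinAt (fun r => embed Λ (evol T Ψ X r s) * embed Λ (evol T Ψ (Λ \ X) r s))
      (-Complex.I • (∑ Z ∈ X.powerset, embed Λ (Ψ Z r) +
        ∑ Z ∈ (Λ \ X).powerset, embed Λ (Ψ Z r)) *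
          (embed Λ (evol T Ψ X r s) * embed Λ (evol T Ψ (Λ \ X) r s))) (Icc (-T) T) r := by
  have hc : Commute (embed Λ (evol T Ψ X r s)) (∑ Z ∈ (Λ \ X).powerset, embed Λ (Ψ Z r)) :=
    Commute.sum_right _ _ _ fun Z hZ => by
      have hZ' := Finset.mem_powerset.1 hZ
      exact commute_embed (Finset.disjoint_of_subset_right hZ' Finset.disjoint_sdiff) hX
        (hZ'.trans Finset.sdiff_subset) _ _
  refine HasDerivWithinAt.congr_deriv ((hasDerivWithinAt_embed_evol hT hΨcont hX s hr).mul
    (hasDerivWithinAt_embed_evol hT hΨcont (Finset.sdiff_subset (t := X)) s hr)) ?_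
  generalize ∑ Z ∈ (Λ \ X).powerset, embed Λ (Ψ Z r) = K at hc
  simp only [smul_mul_assoc, mul_smul_comm, add_mul, smul_add, mul_assoc]
  rw [← mul_assoc _ K, hc.eq, mul_assoc]

theorem surfaceEnergy_eq_embed {𝒢 : SimpleGraph Γ} {X : Finset Γ} {R : ℕ}
    (h : fatBdry 𝒢 X (R / 2) ⊆ fatBdry 𝒢 X R) (r : ℝ) :
    surfaceEnergy 𝒢 Ψ X R r = embed (fatBdry 𝒢 X R)
      (∑ Z ∈ crossing 𝒢 X R, embed (fatBdry 𝒢 X (R / 2)) (Ψ Z r)) := by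
  rw [surfaceEnergy, embed_sum h]
  exact Finset.sum_congr rfl fun Z hZ => (embed_embed
    (Finset.mem_powerset.1 (Finset.mem_filter.1 hZ).1) h (Ψ Z r)).symm

end Factorisation

end SpinSystem

/-! ### The factorisation theorem. -/

theorem theorem1
    {Γ : Type*} [Countable Γ] [DecidableEq Γ] (𝒢 : SimpleGraph Γ) (hconn : 𝒢.Connected)
    {ι : Γ → Type*} [∀ x, Fintype (ι x)] [∀ x, DecidableEq (ι x)]
    -- the decay functions
    (F ξ : ℝ → ℝ) (hFpos : ∀ r, 0 ≤ r → 0 < F r)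
    (hFsum : ∀ x, Summable fun y => F (𝒢.dist x y))
    (hFint : BddAbove (Set.range fun x => ∑' y, F (𝒢.dist x y)))
    (hFconvsum : ∀ x z, Summable fun y => F (𝒢.dist x y) * F (𝒢.dist y z) / F (𝒢.dist x z))
    (hFconv : BddAbove (Set.range fun p : Γ × Γ =>
      ∑' y, F (𝒢.dist p.1 y) * F (𝒢.dist y p.2) / F (𝒢.dist p.1 p.2)))
    (hξpos : ∀ r, 0 ≤ r → 0 < ξ r) (hξanti : AntitoneOn ξ (Set.Ici 0))
    (hξsuper : ∀ a b, 0 ≤ a → 0 ≤ b → ξ a * ξ b ≤ ξ (a + b))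
    (hξdecay : ∀ n : ℕ, Tendsto (fun r : ℝ => ξ r * r ^ n) atTop (𝓝 0))
    -- the interaction
    (T : ℝ) (hT : 0 < T) (Ψ : ∀ Z : Finset Γ, ℝ → SpinSystem.Obs ι Z)
    (hΨempty : ∀ t ∈ Set.Icc (-T) T, Ψ ∅ t = 0)
    (hΨself : ∀ Z, ∀ t ∈ Set.Icc (-T) T, IsSelfAdjoint (Ψ Z t))
    (hΨcont : ∀ Z, ContinuousOn (Ψ Z) (Set.Icc (-T) T))
    (hΨsum : ∀ x y, Summable fun Z : {Z : Finset Γ // x ∈ Z ∧ y ∈ Z} =>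
      SpinSystem.supNorm T Ψ Z)
    (hΨbdd : BddAbove (Set.range fun p : Γ × Γ =>
      SpinSystem.pairStrength 𝒢 (fun r => F r * ξ r) T Ψ p.1 p.2))
    -- the growth of fattened boundaries
    (G d : ℝ) (hG : 0 < G) (hd : 0 ≤ d)
    (hfat : ∀ (Y : Finset Γ) (R : ℕ), ((SpinSystem.fatBoundary 𝒢 Y R).ncard : ℝ) ≤
      G * (R : ℝ) ^ d * (SpinSystem.innerBoundary 𝒢 Y).ncard)
    -- the region, whose inner layers have non-increasing size
    (X : Finset Γ)
    (hX : ∀ n m : ℕ, 1 ≤ n → n ≤ m →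
      (SpinSystem.innerFat 𝒢 X m \ SpinSystem.innerFat 𝒢 X (m - 1)).ncard ≤
        (SpinSystem.innerFat 𝒢 X n \ SpinSystem.innerFat 𝒢 X (n - 1)).ncard)
    (s t : ℝ) (hs : s ∈ Set.Icc (-T) T) (ht : t ∈ Set.Icc (-T) T) :
    -- the finite-volume evolutions are unitary and solve their Schroedinger equations
    (∀ Λ : Finset Γ,
      SpinSystem.IsSolution T s (fun r => -Complex.I • SpinSystem.ham Ψ Λ r)
        (fun r => SpinSystem.evol T Ψ Λ r s) ∧
      SpinSystem.evol T Ψ Λ t s ∈ unitary (SpinSystem.Obs ι Λ)) ∧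
    -- the surface evolution is unitary and solves its equation; the factorisation bound holds
    (∀ (R : ℕ) (Λ : Finset Γ) (hΛ : SpinSystem.outerFat 𝒢 X R ⊆ (Λ : Set Γ)),
      (SpinSystem.fatBdry 𝒢 X R : Set Γ) = SpinSystem.fatBoundary 𝒢 X R ∧
      SpinSystem.IsSolution T s (SpinSystem.surfaceGen 𝒢 T Ψ X R s)
        (fun r => SpinSystem.surfaceEvol 𝒢 T Ψ X R r s) ∧
      SpinSystem.surfaceEvol 𝒢 T Ψ X R t s ∈
        unitary (SpinSystem.Obs ι (SpinSystem.fatBdry 𝒢 X R)) ∧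
      ‖SpinSystem.evol T Ψ Λ t s -
          SpinSystem.tensor (SpinSystem.subset_of_outerFat_subset hΛ)
            (SpinSystem.evol T Ψ X t s) (SpinSystem.evol T Ψ (Λ \ X) t s) *
          SpinSystem.embed Λ (star (SpinSystem.surfaceEvol 𝒢 T Ψ X R t s))‖ ≤
        SpinSystem.errorBound 𝒢 F ξ G d T Ψ X R t s) ∧
    -- the bound decays faster than any inverse power of `R`
    (∀ n : ℕ, Tendsto (fun R : ℕ => SpinSystem.errorBound 𝒢 F ξ G d T Ψ X R t s * (R : ℝ) ^ n)
      atTop (𝓝 0)) := by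
  have hF := hFpos
  have hFξ : ∀ r, 0 ≤ r → 0 < (fun r => F r * ξ r) r := fun r hr => mul_pos (hF r hr) (hξpos r hr)
  refine ⟨fun Λ => ⟨SpinSystem.isSolution_evol hT hΨcont Λ s,
    SpinSystem.evol_mem_unitary hT hΨself hΨcont Λ hs ht⟩, fun R Λ hΛ => ?_,
    fun n => SpinSystem.tendsto_errorBound_mul_pow hξpos hξdecay G hd X t s n⟩
  have hne : Nonempty Γ := hconn.nonempty
  have hXΛ : X ⊆ Λ := SpinSystem.subset_of_outerFat_subset hΛ
  have hhR : R / 2 ≤ R := Nat.div_le_self R 2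
  have hD := SpinSystem.coe_fatBdry hΛ
  have hY := SpinSystem.coe_fatBdry (h := (SpinSystem.outerFat_mono X hhR).trans hΛ)
  set D := SpinSystem.fatBdry 𝒢 X R with hDdef
  set Y := SpinSystem.fatBdry 𝒢 X (R / 2) with hYdef
  have hYD : Y ⊆ D := by
    rw [← Finset.coe_subset, hD, hY]
    exact Set.inter_subset_inter (SpinSystem.outerFat_mono X hhR) (SpinSystem.innerFat_mono X hhR)
  have hDΛ : D ⊆ Λ := by
    rw [← Finset.coe_subset, hD]
    exact Set.inter_subset_left.trans hΛ
  have hYΛ : Y ⊆ Λ := hYD.trans hDΛ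
  have hcrossY : SpinSystem.crossing 𝒢 X R ⊆ Y.powerset := Finset.filter_subset _ _
  have hcrossD : ∀ Z ∈ SpinSystem.crossing 𝒢 X R, Z ⊆ D := fun Z hZ =>
    (Finset.mem_powerset.1 (hcrossY hZ)).trans hYD
  have hSself : ∀ r ∈ Set.Icc (-T) T, IsSelfAdjoint (SpinSystem.heis T Ψ D r s
      (SpinSystem.surfaceEnergy 𝒢 Ψ X R r)) := fun r hr =>
    SpinSystem.isSelfAdjoint_heis r s
      (isSelfAdjoint_sum _ fun Z _ => SpinSystem.isSelfAdjoint_embed D (hΨself Z r hr))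
  have hsol : SpinSystem.IsSolution T s (SpinSystem.surfaceGen 𝒢 T Ψ X R s)
      (fun r => SpinSystem.surfaceEvol 𝒢 T Ψ X R r s) :=
    SpinSystem.isSolution_solution hT s (A := SpinSystem.surfaceGen 𝒢 T Ψ X R s)
      (SpinSystem.continuousOn_surfaceGen hT hΨcont s
        (SpinSystem.continuousOn_sum_embed hΨcont hcrossD))
  have hEu : ∀ r ∈ Set.Icc (-T) T, SpinSystem.surfaceEvol 𝒢 T Ψ X R r s ∈
      unitary (SpinSystem.Obs ι D) := fun r hr =>
    hsol.mem_unitary hs (fun q hq => by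
      rw [SpinSystem.surfaceGen, star_smul, (hSself q hq).star_eq]
      simp only [RCLike.star_def, Complex.conj_I, neg_smul]
      rfl) hr
  refine ⟨hD, hsol, hEu t ht, ?_⟩
  set ψ := SpinSystem.intrNorm 𝒢 (fun r => F r * ξ r) T Ψ with hψdef
  set C := SpinSystem.convConst 𝒢 (fun r => F r * ξ r) with hCdef
  set N := SpinSystem.intNorm 𝒢 F with hNdef
  set Nξ := SpinSystem.intNorm 𝒢 (fun r => F r * ξ r) with hNξdef
  set b : ℝ := ((SpinSystem.innerBoundary 𝒢 X).ncard : ℝ) with hbdef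
  let f : Γ → Γ → ℝ := fun x y => F (𝒢.dist x y) * ξ (𝒢.dist x y)
  have hf : ∀ x y, 0 ≤ f x y := fun _ _ => (hFξ _ (Nat.cast_nonneg _)).le
  have hfsymm : ∀ x y, f x y = f y x := fun x y => by simp only [f, 𝒢.dist_comm]
  have hψ0 : 0 ≤ ψ := SpinSystem.intrNorm_nonneg hFξ
  have hN0 : 0 ≤ N := SpinSystem.intNorm_nonneg hF
  have hNξ0 : 0 ≤ Nξ := SpinSystem.intNorm_nonneg hFξ
  have hconvsum := SpinSystem.summable_conv_weighted hconn hF hξpos hξanti hξsuper hFconvsum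
  have hconvbdd := SpinSystem.bddAbove_conv_weighted hconn hF hξpos hξanti hξsuper hFconvsum hFconv
  have hC : 0 < C := SpinSystem.convConst_pos hFξ hconvsum hconvbdd
  have hψ : ∀ x y, ∑ Z ∈ Λ.powerset with x ∈ Z ∧ y ∈ Z, SpinSystem.supNorm T Ψ Z ≤ ψ * f x y :=
    SpinSystem.sum_supNorm_le_intrNorm hFξ hΨsum hΨbdd Λ.powerset
  have hconv : ∀ x y, ∑ z ∈ Λ, f x z * f z y ≤ C * f x y :=
    SpinSystem.sum_conv_le hFξ hconvsum hconvbdd Λ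
  have hNf : ∀ x, ∑ y ∈ Λ, f x y ≤ Nξ := fun x => SpinSystem.sum_le_intNorm hFξ
    (SpinSystem.summable_weighted hF hξpos hξanti hFsum)
    (SpinSystem.bddAbove_weighted hF hξpos hξanti hFsum hFint) x Λ
  have hξh : 0 < ξ (R / 2 : ℕ) := hξpos _ (Nat.cast_nonneg _)
  -- A point outside `∂_R X` misses the outer or the inner fattening, while `y` lies in both with
  -- radius `⌊R/2⌋`. Either way the distance exceeds `R - ⌊R/2⌋ ≥ ⌊R/2⌋`, so `ξ` can be pulled out
  -- and `F` summed freely.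
  have hfar : ∑ y ∈ Y, ∑ w ∈ Λ \ D, f y w ≤ Y.card * (N * ξ (R / 2 : ℕ)) := by
    rw [← nsmul_eq_mul, ← Finset.sum_const]
    refine Finset.sum_le_sum fun y hy => ?_
    have hy' : y ∈ SpinSystem.fatBoundary 𝒢 X (R / 2) := hY ▸ Finset.mem_coe.2 hy
    refine le_trans (Finset.sum_le_sum fun w hw => ?_) (le_trans
      (Finset.sum_mul (Λ \ D) (fun w => F (𝒢.dist y w)) (ξ (R / 2 : ℕ))).ge
      (mul_le_mul_of_nonneg_right (SpinSystem.sum_le_intNorm hF hFsum hFint y _) hξh.le))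
    have hw' : w ∉ SpinSystem.fatBoundary 𝒢 X R := fun hw' =>
      (Finset.mem_sdiff.1 hw).2 (Finset.mem_coe.1 (hD ▸ hw'))
    have hdist : R / 2 ≤ 𝒢.dist y w := by
      have hlt : R < 𝒢.dist y w + R / 2 := by
        by_cases hout : w ∈ SpinSystem.outerFat 𝒢 X R
        · exact SpinSystem.lt_dist_add_of_setDist hconn hy'.2 fun hin => hw' ⟨hout, hin⟩
        · exact SpinSystem.lt_dist_add_of_setDist hconn hy'.1 hout
      omega
    exact mul_le_mul_of_nonneg_left (hξanti (Set.mem_Ici.2 (Nat.cast_nonneg _))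
      (Set.mem_Ici.2 (Nat.cast_nonneg _)) (by exact_mod_cast hdist))
      (hF _ (Nat.cast_nonneg _)).le
  have hsub : Set.uIcc s t ⊆ Set.Icc (-T) T := Set.uIcc_subset_Icc hs ht
  set S₀ : ℝ → SpinSystem.Obs ι Y := fun r =>
    ∑ Z ∈ SpinSystem.crossing 𝒢 X R, SpinSystem.embed Y (Ψ Z r) with hS₀
  have hS₀norm : ∀ r ∈ Set.Icc (-T) T, ‖S₀ r‖ ≤ ψ * (Y.card * Nξ) := fun r hr =>
    SpinSystem.norm_sum_crossing_le hψ0 hΨcont hψ hNf hYΛ hcrossY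
      (fun Z hZ => (Finset.mem_filter.1 hZ).2.1.mono Finset.inter_subset_left) hr
  set e := Real.exp (2 * ψ * C * |t - s|) - 1 with he
  have he0 : 0 ≤ e := sub_nonneg.2 (Real.one_le_exp (by positivity))
  let P := {Z ∈ Λ.powerset | (Z ∩ X).Nonempty ∧ (Z \ X).Nonempty ∧ ¬Z ⊆ Y}
  have hPnorm : ∑ Z ∈ P, SpinSystem.supNorm T Ψ Z ≤
      b * ψ * N * (2 * SpinSystem.tail ξ (R / 2)) :=
    SpinSystem.sum_crossing_far_le hconn hF hFsum hFint hξpos hξanti hξdecay hX hψ0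
      SpinSystem.supNorm_nonneg hψ (R / 2) (Finset.filter_subset _ _) fun Z hZ => by
        have := (Finset.mem_filter.1 hZ).2
        rw [← hY, Finset.coe_subset]
        exact this
  -- What the product evolution omits is the surface energy plus the crossing terms in `P` that are
  -- not contained in `∂_{R/2} X`.
  have hsplit : ∀ r ∈ Set.Icc (-T) T, SpinSystem.ham Ψ Λ r -
      (∑ Z ∈ X.powerset, SpinSystem.embed Λ (Ψ Z r) +
        ∑ Z ∈ (Λ \ X).powerset, SpinSystem.embed Λ (Ψ Z r)) =
      SpinSystem.embed Λ (S₀ r) + ∑ Z ∈ P, SpinSystem.embed Λ (Ψ Z r) := by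
    intro r hr
    have h0 : SpinSystem.embed Λ (Ψ ∅ r) = 0 := by
      rw [hΨempty r hr, SpinSystem.embed_zero (Finset.empty_subset Λ)]
    have hfilter : ({Z ∈ Λ.powerset | (Z ∩ X).Nonempty ∧ (Z \ X).Nonempty} :
        Finset (Finset Γ)).filter (· ⊆ Y) = SpinSystem.crossing 𝒢 X R := by
      ext Z
      simp only [SpinSystem.crossing, Finset.mem_filter, Finset.mem_powerset, ← hYdef]
      exact ⟨fun h => ⟨h.2, h.1.2⟩, fun h => ⟨⟨h.1.trans hYΛ, h.2⟩, h.1⟩⟩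
    have hfilter' : ({Z ∈ Λ.powerset | (Z ∩ X).Nonempty ∧ (Z \ X).Nonempty} :
        Finset (Finset Γ)).filter (¬· ⊆ Y) = P := by
      rw [Finset.filter_filter]
      simp only [P, and_assoc]
    rw [SpinSystem.ham, SpinSystem.sum_powerset_eq_add hXΛ
      (g := fun Z => SpinSystem.embed Λ (Ψ Z r)) h0, add_sub_cancel_left,
      ← Finset.sum_filter_add_sum_filter_not _ (· ⊆ Y), hfilter, hfilter',
      SpinSystem.embed_sum hYΛ]
    congr 1
    exact Finset.sum_congr rfl fun Z hZ => (SpinSystem.embed_embed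
      (Finset.mem_powerset.1 (hcrossY hZ)) hYΛ (Ψ Z r)).symm
  have hUu : ∀ Λ₀ : Finset Γ, ∀ r ∈ Set.Icc (-T) T,
      SpinSystem.evol T Ψ Λ₀ r s ∈ unitary (SpinSystem.Obs ι Λ₀) := fun Λ₀ r hr =>
    SpinSystem.evol_mem_unitary hT hΨself hΨcont Λ₀ hs hr
  have hXc : Λ \ X ⊆ Λ := Finset.sdiff_subset
  have hUs : ∀ Λ₀ : Finset Γ, SpinSystem.evol T Ψ Λ₀ s s = 1 := fun Λ₀ =>
    (SpinSystem.isSolution_evol hT hΨcont Λ₀ s).1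
  have hmain := SpinSystem.norm_sub_mul_star_le (𝔄 := SpinSystem.Obs ι Λ) (s := s) (t := t)
    (H := fun r => SpinSystem.ham Ψ Λ r)
    (K := fun r => ∑ Z ∈ X.powerset, SpinSystem.embed Λ (Ψ Z r) +
        ∑ Z ∈ (Λ \ X).powerset, SpinSystem.embed Λ (Ψ Z r))
    (G := fun r => SpinSystem.embed Λ (SpinSystem.heis T Ψ D r s
      (SpinSystem.surfaceEnergy 𝒢 Ψ X R r)))
    (U := fun r => SpinSystem.evol T Ψ Λ r s)
    (V := fun r => SpinSystem.embed Λ (SpinSystem.evol T Ψ X r s) *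
      SpinSystem.embed Λ (SpinSystem.evol T Ψ (Λ \ X) r s))
    (E := fun r => SpinSystem.embed Λ (SpinSystem.surfaceEvol 𝒢 T Ψ X R r s))
    (c := b * ψ * N * (2 * SpinSystem.tail ξ (R / 2)) +
      ψ * (Y.card * Nξ) * C⁻¹ * e * (Y.card * (N * ξ (R / 2 : ℕ))))
    (fun r hr => SpinSystem.isSelfAdjoint_ham hΨself Λ (hsub hr))
    (fun r hr => SpinSystem.isSelfAdjoint_embed Λ (hSself r (hsub hr)))
    (hUs Λ)
    (by rw [hUs, hUs, SpinSystem.embed_one hXΛ, SpinSystem.embed_one hXc, one_mul])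
    (by rw [show SpinSystem.surfaceEvol 𝒢 T Ψ X R s s = 1 from hsol.1, SpinSystem.embed_one hDΛ])
    (fun r hr => ((SpinSystem.isSolution_evol hT hΨcont Λ s).2 r (hsub hr)).mono hsub)
    (fun r hr => (SpinSystem.hasDerivWithinAt_embed_evol_mul_embed_evol hT hΨcont hXΛ s
      (hsub hr)).mono hsub)
    (fun r hr => ((SpinSystem.hasDerivWithinAt_embed hDΛ (hsol.2 r (hsub hr))).mono
      hsub).congr_deriv (by
        rw [SpinSystem.embed_mul hDΛ, SpinSystem.surfaceGen, SpinSystem.embed_smul hDΛ]))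
    (fun r hr => hUu Λ r (hsub hr))
    (fun r hr => mul_mem (SpinSystem.embed_mem_unitary hXΛ (hUu X r (hsub hr)))
      (SpinSystem.embed_mem_unitary hXc (hUu (Λ \ X) r (hsub hr))))
    (fun r hr => SpinSystem.embed_mem_unitary hDΛ (hEu r (hsub hr)))
    (fun r hr => by
      have hr' := hsub hr
      have hloc := SpinSystem.norm_heis_sub_embed_heis_le hT hΨself hΨcont hf hfsymm hψ0 hC hψ hconv
        hYD hDΛ hs hr' (S₀ r)
      have hSe : SpinSystem.surfaceEnergy 𝒢 Ψ X R r = SpinSystem.embed D (S₀ r) :=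
        SpinSystem.surfaceEnergy_eq_embed hYD r
      rw [hsplit r hr', hSe, mul_add, add_mul, add_sub_right_comm, add_comm]
      refine (norm_add_le _ _).trans (add_le_add ?_ (hloc.trans ?_))
      · rw [SpinSystem.norm_star_mul_mul_of_mem_unitary (hUu Λ r hr')]
        refine (norm_sum_le_of_le _ fun Z hZ => ?_).trans hPnorm
        exact (SpinSystem.norm_embed_le (Finset.mem_powerset.1 (Finset.mem_filter.1 hZ).1) _).trans
          (SpinSystem.norm_le_supNorm hΨcont Z hr')
      -- The Lieb-Robinson factor at an intermediate time is replaced by its value at `t`, so that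
      -- `c` is constant along the interval.
      · have hrs : Real.exp (2 * ψ * C * |r - s|) - 1 ≤ e := by
          have := mul_le_mul_of_nonneg_left (Set.abs_sub_left_of_mem_uIcc hr)
            (by positivity : 0 ≤ 2 * ψ * C)
          exact sub_le_sub_right (Real.exp_le_exp.2 this) 1
        have hrs0 : 0 ≤ Real.exp (2 * ψ * C * |r - s|) - 1 :=
          sub_nonneg.2 (Real.one_le_exp (by positivity))
        have h1 := hS₀norm r hr'
        have h2 : 0 ≤ ∑ y ∈ Y, ∑ w ∈ Λ \ D, f y w :=
          Finset.sum_nonneg fun _ _ => Finset.sum_nonneg fun _ _ => hf _ _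
        gcongr)
  rw [SpinSystem.tensor_eq_embed_mul_embed, SpinSystem.embed_star hDΛ]
  refine hmain.trans ?_
  have hYcard : (Y.card : ℝ) ≤ G * ((R / 2 : ℕ) : ℝ) ^ d * b := by
    rw [← Set.ncard_coe_finset, hY]
    exact hfat X (R / 2)
  have hpow : ((R / 2 : ℕ) : ℝ) ^ (2 * d) = (((R / 2 : ℕ) : ℝ) ^ d) ^ 2 := by
    rw [mul_comm, Real.rpow_mul (Nat.cast_nonneg _), Real.rpow_two]
  calc (b * ψ * N * (2 * SpinSystem.tail ξ (R / 2)) +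
        ψ * (Y.card * Nξ) * C⁻¹ * e * (Y.card * (N * ξ (R / 2 : ℕ)))) * |t - s|
      ≤ (b * ψ * N * (2 * SpinSystem.tail ξ (R / 2)) +
        ψ * (G * ((R / 2 : ℕ) : ℝ) ^ d * b * Nξ) * C⁻¹ * e *
          (G * ((R / 2 : ℕ) : ℝ) ^ d * b * (N * ξ (R / 2 : ℕ)))) * |t - s| := by
        gcongr
    _ = SpinSystem.errorBound 𝒢 F ξ G d T Ψ X R t s := by
        simp only [SpinSystem.errorBound, hpow]
        simp only [← hψdef, ← hCdef, ← hNdef, ← hNξdef, ← hbdef, ← he]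
        ring
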